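/- Let $q=p^h$ with $p$ prime, let $m>1$ be a divisor of $n$, put $r=n/m$, and let $k\ge 1$ with $\gcd(k,n)=1$. For $a\in\mathbb F_{q^n}$ and $0\le j\le m-1$ let $f^{(k)}_{a,j}$ be the $\mathbb F_q$-bilinear form on $\mathbb F_{q^m}\times\mathbb F_{q^n}$ given by $$f^{(k)}_{a,j}(x,x')=\mathrm{Tr}_{q^n/q}\bigl(a\,x\,x'^{\,q^{kj}}\bigr),$$ and let $\Omega^{(k)}_j=\{f^{(k)}_{a,j}:a\in\mathbb F_{q^n}\}$. For $t\in\{1,\dots,m-2\}$, $\mu\in\mathbb F_{q^n}$ and an integer $s$ let $$\mathcal H^{(k)}_{m,n,t,\mu,s}=\{f^{(k)}_{a,0}+f^{(k)}_{\mu a^{q^{sk}},t}:a\in\mathbb F_{q^n}\}\oplus\Omega^{(k)}_1\oplus\dots\oplus\Omega^{(k)}_{t-1},$$ the code obtained by puncturing (restricting to $\mathbb F_{q^m}\times\mathbb F_{q^n}$) the generalized twisted Gabidulin code $\mathcal H^{(k)}_{n,n,t,\mu,s}$ of bilinear forms on $\mathbb F_{q^n}\times\mathbb F_{q^n}$. (A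 power $x^{q^z}$ with $z\in\mathbb Z$ is the image of $x$ under the $z$-th power of the automorphism $x\mapsto x^q$ of the field.) Let $\Omega_{m,n}$ be the space of all $\mathbb F_q$-bilinear forms on $\mathbb F_{q^m}\times\mathbb F_{q^n}$; the rank of a form is the codimension of its left radical. Two subsets of $\Omega_{m,n}$ are equivalent if an invertible semilinear rank-preserving transformation of $\Omega_{m,n}$ maps the first onto the second. Let $t\in\{1,\dots,m-2\}$, let $s,u$ be integers with $s\not\equiv 0,\pm1,\pm2\pmod m$, and let $\mu,\nu\in\mathbb F_{q^n}$ with $\mu\ne0$ and $\mathrm N_{q^n/q}(\mu)\ne(-1)^{nt}\ne \mathrm N_{q^n/q}(\nu)$. Consider the condition $(\ast)$ There exist $j\in\{0,\dots,r-1\}$ with $s\equiv u+jm\pmod n$, an integer $e\ge0$, an integer $i$, a non-zero $a\in\mathbb F_{q^m}$ and elements $b_0,b_m,\dots,b_{(r-1)m}\in\mathbb F_{q^n}$ such that $$a\,\mu^{p^e q^{k((r-h)m+i)}}\,b_{hm}^{\,q^{k((r-h)m+t)}}=a^{q^{ku}}\,\nu\, b_{(h-j)m}^{\,q^{k((j-h)m+u)}}\qquad\text{for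 } 0\le h\le r-1$$ (indices of $b$ modulo $n$), and such that the $n\times n$ $q^k$-circulant matrix with $(x,y)$ entry $b_{y-x}^{\,q^{kx}}$ $(0\le x,y\le n-1)$ is non-singular, where $b_l=0$ for every $l$ not divisible by $m$. If $m<n$, then $\mathcal H^{(k)}_{m,n,t,\mu,s}$ and $\mathcal H^{(k)}_{m,n,t,\nu,u}$ are equivalent if and only if $(\ast)$ holds. If $m=n$, then some transformation of the form $f\mapsto f^\tau$, $f^\tau(v,v')=\theta\bigl(f(g v,g' v')\bigr)$, with $\theta\in\mathrm{Aut}(\mathbb F_q)$ and $g,g'$ invertible $\theta^{-1}$-semilinear maps (that is, an element of $(\mathrm{GL}(V)\times\mathrm{GL}(V'))\rtimes\mathrm{Aut}(\mathbb F_q)$, where $V=\mathbb F_{q^m}$ and $V'=\mathbb F_{q^n}$), maps $\mathcal H^{(k)}_{m,n,t,\mu,s}$ onto $\mathcal H^{(k)}_{m,n,t,\nu,u}$ if and only if $(\ast)$ holds. -/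

import Mathlib

namespace PuncturedCodes

noncomputable section

section RankMetric

variable {K V V' : Type*} [Field K] [AddCommGroup V] [Module K V] [AddCommGroup V'] [Module K V']

/-- The rank of a bilinear form `f` on `V × V'`: the codimension of its left radical
`{v | ∀ v', f v v' = 0}`, which is the kernel of `f` seen as a map `V → (V' → K)`. -/
def formRank (f : V →ₗ[K] V' →ₗ[K] K) : ℕ :=
  Module.finrank K V - Module.finrank K (LinearMap.ker f)

/-- An automorphism of the rank metric space `Ω(V, V')` of all bilinear forms on `V × V'`: an
invertible semilinear transformation of `Ω(V, V')` that preserves the rank. -/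
def IsRankAut (τ : (V →ₗ[K] V' →ₗ[K] K) ≃+ (V →ₗ[K] V' →ₗ[K] K)) : Prop :=
  (∃ θ : K ≃+* K, ∀ (c : K) (f : V →ₗ[K] V' →ₗ[K] K), τ (c • f) = θ c • τ f) ∧
    ∀ f : V →ₗ[K] V' →ₗ[K] K, formRank (τ f) = formRank f

/-- Two sets of bilinear forms are equivalent if some automorphism of the rank metric space
`Ω(V, V')` maps the first one onto the second one. -/
def CodeEquiv (X₁ X₂ : Set (V →ₗ[K] V' →ₗ[K] K)) : Prop :=
  ∃ τ : (V →ₗ[K] V' →ₗ[K] K) ≃+ (V →ₗ[K] V' →ₗ[K] K), IsRankAut τ ∧ τ '' X₁ = X₂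

/-- The transformations in `(GL(V) × GL(V')) ⋊ Aut(K)`, that is
`f ↦ ((v, v') ↦ θ (f (g v, g' v')))` with `θ ∈ Aut(K)` and `g`, `g'` invertible and semilinear
with respect to `θ⁻¹` (so that the result is again bilinear). -/
def IsProductAut (τ : (V →ₗ[K] V' →ₗ[K] K) ≃+ (V →ₗ[K] V' →ₗ[K] K)) : Prop :=
  ∃ (θ : K ≃+* K) (g : V ≃+ V) (g' : V' ≃+ V'),
    (∀ (c : K) (v : V), g (c • v) = θ.symm c • g v) ∧
    (∀ (c : K) (v' : V'), g' (c • v') = θ.symm c • g' v') ∧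
    ∀ (f : V →ₗ[K] V' →ₗ[K] K) (v : V) (v' : V'), τ f v v' = θ (f (g v) (g' v'))

/-- Equivalence of two sets of bilinear forms under the group `(GL(V) × GL(V')) ⋊ Aut(K)`. -/
def ProductEquiv (X₁ X₂ : Set (V →ₗ[K] V' →ₗ[K] K)) : Prop :=
  ∃ τ : (V →ₗ[K] V' →ₗ[K] K) ≃+ (V →ₗ[K] V' →ₗ[K] K), IsProductAut τ ∧ τ '' X₁ = X₂

end RankMetric

section Frobenius

variable (K : Type*) {L : Type*} [Field K] [Fintype K] [Field L] [Finite L] [Algebra K L]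

/-- `frobPow K z` is the automorphism `x ↦ x ^ (q ^ z)` of `L` over `K`, with `q = |K|` and any
integer `z`; a negative `z` means a power of the inverse of `x ↦ x ^ q`. -/
def frobPow (z : ℤ) : L ≃ₐ[K] L := FiniteField.frobeniusAlgEquivOfAlgebraic K L ^ z

theorem frobPow_natCast (z : ℕ) (x : L) : frobPow K (z : ℤ) x = x ^ Fintype.card K ^ z := by
  have h := congrFun (FiniteField.coe_frobeniusAlgEquivOfAlgebraic_iterate K L z) x
  rw [frobPow, zpow_natCast, AlgEquiv.coe_pow]
  exact h

end Frobenius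

section Codes

variable (K F L : Type*) [Field K] [Fintype K] [Field F] [Field L] [Finite L]
  [Algebra K F] [Algebra K L] [Algebra F L] [IsScalarTower K F L]

/-- The `k`-cyclic model `{(x, x^{q^k}, …, x^{q^{k(n-1)}})}` of an `n`-dimensional space is
parametrised by `x ∈ L = 𝔽_{q^n}`. In this parameter, `cyclicForm K L k j a` is the bilinear form
`f_{a,j}^{(k)}(x, x') = Tr_{L/K}(a x x'^{q^{kj}})`. -/
def cyclicForm (k j : ℕ) (a : L) : L →ₗ[K] L →ₗ[K] K :=
  LinearMap.mk₂ K (fun x x' => Algebra.trace K L (a * x * frobPow K ((k * j : ℕ) : ℤ) x'))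
    (fun x y x' => by rw [mul_add, add_mul, map_add])
    (fun c x x' => by rw [mul_smul_comm, smul_mul_assoc, map_smul])
    (fun x y z => by rw [map_add, mul_add, map_add])
    (fun c x x' => by rw [map_smul, mul_smul_comm, map_smul])

theorem cyclicForm_apply (k j : ℕ) (a x x' : L) :
    cyclicForm K L k j a x x' = Algebra.trace K L (a * x * frobPow K ((k * j : ℕ) : ℤ) x') := rfl

theorem cyclicForm_add (k j : ℕ) (a b : L) :
    cyclicForm K L k j (a + b) = cyclicForm K L k j a + cyclicForm K L k j b := by
  ext x x'
  simp only [cyclicForm_apply, LinearMap.add_apply, add_mul, map_add]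

theorem cyclicForm_smul (k j : ℕ) (c : K) (a : L) :
    cyclicForm K L k j (c • a) = c • cyclicForm K L k j a := by
  ext x x'
  simp only [cyclicForm_apply, LinearMap.smul_apply, smul_mul_assoc, map_smul]

/-- `Ω_j^{(k)} = {f_{a,j}^{(k)} : a ∈ L}`. -/
def component (k j : ℕ) : Submodule K (L →ₗ[K] L →ₗ[K] K) :=
  LinearMap.range
    ({ toFun := cyclicForm K L k j
       map_add' := cyclicForm_add K L k j
       map_smul' := cyclicForm_smul K L k j } : L →ₗ[K] L →ₗ[K] L →ₗ[K] K)

/-- `Γ_{n,n,t,μ,s}^{(k)} = {f_{a,0}^{(k)} + f_{μ a^{q^{sk}},t}^{(k)} : a ∈ L}`. -/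
def twistedPart (k t : ℕ) (μ : L) (s : ℤ) : Submodule K (L →ₗ[K] L →ₗ[K] K) :=
  LinearMap.range
    ({ toFun := fun a => cyclicForm K L k 0 a + cyclicForm K L k t (μ * frobPow K (s * k) a)
       map_add' := fun a b => by
         rw [map_add, mul_add, cyclicForm_add, cyclicForm_add]
         abel
       map_smul' := fun c a => by
         rw [map_smul, mul_smul_comm, cyclicForm_smul, cyclicForm_smul, RingHom.id_apply,
           smul_add] } : L →ₗ[K] L →ₗ[K] L →ₗ[K] K)

/-- The generalized twisted Gabidulin code
`H_{n,n,t,μ,s}^{(k)} = Γ_{n,n,t,μ,s}^{(k)} + Ω_1^{(k)} + … + Ω_{t-1}^{(k)}`. -/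
def twistedGabidulin (k t : ℕ) (μ : L) (s : ℤ) : Submodule K (L →ₗ[K] L →ₗ[K] K) :=
  twistedPart K L k t μ s ⊔ ⨆ j ∈ Finset.Icc 1 (t - 1), component K L k j

/-- Restriction of a bilinear form from `L × L` to `F × L`, where `F = 𝔽_{q^m} ⊆ L = 𝔽_{q^n}`.
In the `k`-th Singer bases the vectors `s_i = ∑_j s'_{i+jm}` span the `k`-cyclic model of the
`m`-dimensional space inside that of the `n`-dimensional space, and the vector of the former with
parameter `x ∈ F` is the vector of the latter with the same parameter `x`; so this is left
multiplication of the matrix of the form by `(I_m | I_m | ⋯ | I_m)`. -/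
def puncture : (L →ₗ[K] L →ₗ[K] K) →ₗ[K] (F →ₗ[K] L →ₗ[K] K) :=
  LinearMap.lcomp K (L →ₗ[K] K) (IsScalarTower.toAlgHom K F L).toLinearMap

theorem puncture_apply (f : L →ₗ[K] L →ₗ[K] K) (x : F) (x' : L) :
    puncture K F L f x x' = f (algebraMap F L x) x' := rfl

/-- The punctured code `H_{m,n,t,μ,s}^{(k)}`, a subspace of the space of all bilinear forms on
`F × L`, with `F = 𝔽_{q^m}` and `L = 𝔽_{q^n}`. -/
def puncturedTwistedGabidulin (k t : ℕ) (μ : L) (s : ℤ) :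
    Submodule K (F →ₗ[K] L →ₗ[K] K) :=
  (twistedGabidulin K L k t μ s).map (puncture K F L)

/-- The `n × n` `q^k`-circulant matrix generated by the array `b = (b_0, …, b_{n-1})`: its
`(i, j)` entry is `b_{j-i}^{q^{ki}}`, the index of `b` being taken modulo `n`. -/
def circulant {n : ℕ} (k : ℕ) (b : ZMod n → L) : Matrix (Fin n) (Fin n) L :=
  Matrix.of fun i j => frobPow K ((k * i.val : ℕ) : ℤ) (b ((j.val : ZMod n) - (i.val : ZMod n)))

/-- The arithmetic condition on `μ, s` and `ν, u`. Here `r = n / m`; the array `b` is indexed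
modulo `n` and vanishes outside the positions `0, m, …, (r-1)m`. Every exponent of `q` is
multiplied by `k`, since `q^k` plays the role of `q` in the `k`-cyclic model. -/
def EquivCondition (p m n k t : ℕ) (μ ν : L) (s u : ℤ) : Prop :=
  ∃ j ∈ Finset.range (n / m), s ≡ u + j * m [ZMOD n] ∧
    ∃ (e : ℕ) (i : ℤ) (a : F) (b : ZMod n → L),
      a ≠ 0 ∧
      (∀ l : ZMod n, b l ≠ 0 → ∃ h : ℕ, l = ((h * m : ℕ) : ZMod n)) ∧
      (circulant K L k b).det ≠ 0 ∧
      ∀ h ∈ Finset.range (n / m),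
        algebraMap F L a *
            frobPow K (k * ((((n / m : ℕ) : ℤ) - h) * m + i)) (μ ^ p ^ e) *
            frobPow K (k * ((((n / m : ℕ) : ℤ) - h) * m + t)) (b ((h * m : ℕ) : ZMod n)) =
          frobPow K (k * u) (algebraMap F L a) * ν *
            frobPow K (k * (((j : ℤ) - h) * m + u)) (b (((h : ZMod n) - (j : ZMod n)) * m))

end Codes

end

end PuncturedCodes

set_option linter.unusedSectionVars false

/-! Every form on `F × L` is `(x, y) ↦ Tr(y X(x))` for a unique `K`-linear `X : F → L`, and `X` is a
unique linearized polynomial `∑ c_i x^(q^(κ i))` with `i` modulo `m`. For `κ = -k` the code becomes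
the set of all `c` with `c_i = 0` for `i > t` and `c_t = η c_0^(q^(κ w))`, where `η = μ^(q^(κ t))`
and `w = t - s` (`mem_puncturedTwistedGabidulin_iff`).

A product transformation turns `X` into `B ∘ X' ∘ A`: the coefficients of `X'` are the `p^e`-th
powers of those of `X`, `A` is a linear bijection of `F`, and `B` is the trace adjoint of a linear
bijection of `L`. Let `a_i` (`i` modulo `m`) and `b_l` (`l` modulo `n`) be the coefficients of `A`
and `B`. The heart of the proof is that `a_i ≠ 0` and `b_l ≠ 0` force `i + l = 0` modulo `m`. Then
`A` is a monomial, `B` lives on one residue class modulo `m`, and the link between the coefficients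
at `0` and `t` becomes the equation of the arithmetic condition together with `s ≡ u` modulo `m`
(`monomial_of_maps_isTwistedCoeff`).

For `t ≥ 2` the components strictly between `0` and `t` leave only `i + l ∈ {0, 1, -1}`, and the
twisted part excludes `±1` (`add_eq_zero_of_two_le`). For `t = 1`, a pair with `i + l ≠ 0` would
force a recursion on all the `a_i` which says that `A` is fixed by a non-trivial twist, against its
surjectivity (`add_eq_zero_of_one`). The excluded residues of `s` enter exactly here.

Conversely, the condition provides a transformation that maps the first code into the second, and
the codes have equal size. For `m < n` every rank automorphism is a product transformation
(`IsRankAut.isProductAut`); for `m = n` the two factors can also be interchanged, so the statement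
is about the product group only. -/

namespace PuncturedCodes

noncomputable section

/-! ### Powers of the Frobenius automorphism, with exponents modulo `n`. -/

section FrobeniusPowers

variable {K L : Type*} [Field K] [Fintype K] [Field L] [Finite L] [Algebra K L]

theorem frobPow_add (y z : ℤ) (x : L) : frobPow K (y + z) x = frobPow K y (frobPow K z x) := by
  simp only [frobPow, zpow_add, AlgEquiv.mul_apply]

theorem frobPow_zero (x : L) : frobPow K 0 x = x := by simp [frobPow]

theorem frobPow_eq_frobPow_iff {y z : ℤ} :
    (frobPow K y : L ≃ₐ[K] L) = frobPow K z ↔ y ≡ z [ZMOD Module.finrank K L] := by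
  rw [frobPow, frobPow, zpow_eq_zpow_iff_modEq, FiniteField.orderOf_frobeniusAlgEquivOfAlgebraic]

theorem frobPow_algebraMap {F : Type*} [Field F] [Finite F] [Algebra K F] [Algebra F L]
    [IsScalarTower K F L] (z : ℤ) (x : F) :
    frobPow K z (algebraMap F L x) = algebraMap F L (frobPow K z x) := by
  have key : ∀ (z : ℕ) (x : F),
      frobPow K (z : ℤ) (algebraMap F L x) = algebraMap F L (frobPow K (z : ℤ) x) := fun z x => by
    rw [frobPow_natCast, frobPow_natCast, map_pow]
  obtain ⟨w, rfl | rfl⟩ := z.eq_nat_or_neg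
  · exact key w x
  · apply (frobPow K (w : ℤ) : L ≃ₐ[K] L).injective
    rw [key, ← frobPow_add, ← frobPow_add, add_neg_cancel, frobPow_zero, frobPow_zero]

variable (K) in
/-- The automorphism `x ↦ x ^ (q ^ (κ z))` of `L`, with the exponent `z` read modulo `n`. -/
def twist (κ : ℤ) {n : ℕ} (z : ZMod n) : L ≃ₐ[K] L := frobPow K (κ * (z.cast : ℤ))

variable {n : ℕ} {κ : ℤ}

theorem twist_intCast (hn : Module.finrank K L = n) (z : ℤ) :
    (twist K κ (z : ZMod n) : L ≃ₐ[K] L) = frobPow K (κ * z) := by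
  rw [twist, frobPow_eq_frobPow_iff, hn]
  refine Int.ModEq.mul_left _ ?_
  rw [← ZMod.intCast_eq_intCast_iff]
  simp

theorem twist_add (hn : Module.finrank K L = n) (y z : ZMod n) (x : L) :
    twist K κ (y + z) x = twist K κ y (twist K κ z x) := by
  obtain ⟨y, rfl⟩ := ZMod.intCast_surjective y
  obtain ⟨z, rfl⟩ := ZMod.intCast_surjective z
  rw [← Int.cast_add, twist_intCast hn, twist_intCast hn, twist_intCast hn, mul_add, frobPow_add]

theorem twist_zero (x : L) : twist K κ (0 : ZMod n) x = x := by
  simp [twist, frobPow_zero]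

theorem twist_neg_apply_twist (hn : Module.finrank K L = n) (z : ZMod n) (x : L) :
    twist K κ (-z) (twist K κ z x) = x := by
  rw [← twist_add hn, neg_add_cancel, twist_zero]

theorem twist_apply_twist_neg (hn : Module.finrank K L = n) (z : ZMod n) (x : L) :
    twist K κ z (twist K κ (-z) x) = x := by
  rw [← twist_add hn, add_neg_cancel, twist_zero]

/-- The Frobenius automorphism has order `n`, so its `κ`-th power is still a generator of the Galois
group. -/
theorem twist_injective (hn : Module.finrank K L = n) (hκ : IsCoprime κ n) :
    Function.Injective (twist K κ : ZMod n → L ≃ₐ[K] L) := by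
  intro y z h
  obtain ⟨y, rfl⟩ := ZMod.intCast_surjective y
  obtain ⟨z, rfl⟩ := ZMod.intCast_surjective z
  rw [twist_intCast hn, twist_intCast hn, frobPow_eq_frobPow_iff, hn] at h
  rw [ZMod.intCast_eq_intCast_iff]
  rw [Int.modEq_iff_dvd, ← mul_sub] at h
  rw [Int.modEq_iff_dvd]
  exact hκ.symm.dvd_of_dvd_mul_left h

theorem trace_twist (z : ZMod n) (x : L) :
    Algebra.trace K L (twist K κ z x) = Algebra.trace K L x :=
  Algebra.trace_eq_of_algEquiv _ _

theorem trace_mul_twist (hn : Module.finrank K L = n) (z : ZMod n) (x y : L) :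
    Algebra.trace K L (x * twist K κ z y) = Algebra.trace K L (y * twist K κ (-z) x) := by
  rw [← trace_twist (κ := κ) (-z), map_mul, twist_neg_apply_twist hn, mul_comm]

theorem eq_of_forall_trace_mul {x x' : L}
    (h : ∀ y, Algebra.trace K L (y * x) = Algebra.trace K L (y * x')) : x = x' := by
  have hx := (traceForm_nondegenerate K L).2 (x - x') fun y => by
    rw [Algebra.traceForm_apply, mul_sub, map_sub, h, sub_self]
  exact sub_eq_zero.1 hx

end FrobeniusPowers

/-! ### Linear maps as linearized polynomials. -/

section Expansion

variable (K F L : Type*) [Field K] [Fintype K] [Field F] [Finite F] [Field L] [Finite L]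
  [Algebra K F] [Algebra K L] [Algebra F L] [IsScalarTower K F L]

/-- The embedding `x ↦ x ^ (q ^ (κ i))` of `F` in `L`. -/
def twistEmb (κ : ℤ) {m : ℕ} (i : ZMod m) : F →ₐ[K] L :=
  (IsScalarTower.toAlgHom K F L).comp (twist K κ i : F ≃ₐ[K] F).toAlgHom

variable {K F L} {m n : ℕ} {κ : ℤ}

theorem twistEmb_apply (i : ZMod m) (x : F) :
    twistEmb K F L κ i x = algebraMap F L (twist K κ i x) := rfl

theorem twistEmb_self (i : ZMod m) (x : L) : twistEmb K L L κ i x = twist K κ i x := rfl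

theorem twist_algebraMap (hm : Module.finrank K F = m) (hn : Module.finrank K L = n) (hmn : m ∣ n)
    (z : ZMod n) (x : F) :
    twist K κ z (algebraMap F L x) = algebraMap F L (twist K κ (ZMod.castHom hmn (ZMod m) z) x) := by
  obtain ⟨z, rfl⟩ := ZMod.intCast_surjective z
  rw [map_intCast, twist_intCast hn, twist_intCast hm, frobPow_algebraMap]

theorem twist_twistEmb (hm : Module.finrank K F = m) (hn : Module.finrank K L = n) (hmn : m ∣ n)
    (z : ZMod n) (i : ZMod m) (x : F) :
    twist K κ z (twistEmb K F L κ i x) =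
      twistEmb K F L κ (ZMod.castHom hmn (ZMod m) z + i) x := by
  rw [twistEmb_apply, twist_algebraMap hm hn hmn, ← twist_add hm, twistEmb_apply]

theorem twistEmb_injective (hm : Module.finrank K F = m) (hκ : IsCoprime κ m) :
    Function.Injective (twistEmb K F L κ : ZMod m → F →ₐ[K] L) := by
  intro i j h
  refine twist_injective hm hκ (AlgEquiv.ext fun x => (algebraMap F L).injective ?_)
  exact DFunLike.congr_fun h x

variable [NeZero m]

/-- Dedekind's independence of characters, applied to the distinct embeddings of `F` in `L`. -/
theorem eq_of_sum_twistEmb_eq (hm : Module.finrank K F = m) (hκ : IsCoprime κ m) {c d : ZMod m → L}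
    (h : ∀ x : F, ∑ i, c i * twistEmb K F L κ i x = ∑ i, d i * twistEmb K F L κ i x) :
    c = d := by
  have hli := (linearIndependent_monoidHom F L).comp
    (fun i : ZMod m => (twistEmb K F L κ i : F →* L)) fun i j hij =>
      twistEmb_injective hm hκ (AlgHom.ext fun x => DFunLike.congr_fun hij x)
  rw [Fintype.linearIndependent_iff] at hli
  funext i
  refine sub_eq_zero.1 (hli (fun i => c i - d i) (funext fun x => ?_) i)
  simp only [Finset.sum_apply, Pi.smul_apply, Function.comp_apply, smul_eq_mul, Pi.zero_apply,
    sub_mul, Finset.sum_sub_distrib]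
  exact sub_eq_zero.2 (h x)

theorem eq_of_sum_twist_eq [NeZero n] (hn : Module.finrank K L = n) (hκ : IsCoprime κ n)
    {c d : ZMod n → L} (h : ∀ x : L, ∑ i, c i * twist K κ i x = ∑ i, d i * twist K κ i x) :
    c = d :=
  eq_of_sum_twistEmb_eq (F := L) hn hκ h

variable (κ) in
/-- The `K`-linear map `x ↦ ∑ c_i x ^ (q ^ (κ i))`. -/
def linPoly (c : ZMod m → L) : F →ₗ[K] L :=
  ∑ i, c i • (twistEmb K F L κ i).toLinearMap

theorem linPoly_apply (c : ZMod m → L) (x : F) :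
    (linPoly κ c : F →ₗ[K] L) x = ∑ i, c i * twistEmb K F L κ i x := by
  simp [linPoly]

theorem linPoly_injective (hm : Module.finrank K F = m) (hκ : IsCoprime κ m) :
    Function.Injective (linPoly κ : (ZMod m → L) → F →ₗ[K] L) := fun c d h =>
  eq_of_sum_twistEmb_eq hm hκ fun x => by rw [← linPoly_apply, h, linPoly_apply]

theorem linPoly_surjective (hm : Module.finrank K F = m) (hκ : IsCoprime κ m) :
    Function.Surjective (linPoly κ : (ZMod m → L) → F →ₗ[K] L) := by
  have hfin : Finite (F →ₗ[K] L) := Module.finite_of_finite K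
  -- Both sides have `q^(mn)` elements.
  refine ((Nat.bijective_iff_injective_and_card _).2 ⟨linPoly_injective hm hκ, ?_⟩).2
  rw [Module.natCard_eq_pow_finrank (K := K) (V := F →ₗ[K] L), Module.finrank_linearMap,
    Nat.card_fun, Module.natCard_eq_pow_finrank (K := K) (V := L), ← pow_mul, hm, mul_comm,
    Nat.card_zmod]

end Expansion

/-! ### Bilinear forms of rank at most one. -/

section RankOne

variable {K V V' : Type*} [Field K] [AddCommGroup V] [Module K V] [FiniteDimensional K V]
  [AddCommGroup V'] [Module K V'] [FiniteDimensional K V']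

theorem formRank_eq_finrank_range (f : V →ₗ[K] V' →ₗ[K] K) :
    formRank f = Module.finrank K (LinearMap.range f) := by
  rw [formRank, ← f.finrank_range_add_finrank_ker, Nat.add_sub_cancel]

theorem formRank_smulRight_le_one (φ : Module.Dual K V) (ψ : Module.Dual K V') :
    formRank (φ.smulRight ψ) ≤ 1 := by
  rw [formRank_eq_finrank_range]
  refine (Submodule.finrank_mono (t := Submodule.span K {ψ}) ?_).trans ?_
  · rintro _ ⟨v, rfl⟩
    exact Submodule.smul_mem _ _ (Submodule.mem_span_singleton_self ψ)
  · exact (finrank_span_le_card _).trans (by simp)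

theorem exists_eq_smulRight_of_finrank_range_le_one {W : Type*} [AddCommGroup W] [Module K W]
    {f : V →ₗ[K] W} (hf : Module.finrank K (LinearMap.range f) ≤ 1) :
    ∃ (φ : Module.Dual K V) (w : W), f = φ.smulRight w := by
  obtain ⟨⟨w, hw⟩, h⟩ := finrank_le_one_iff.1 hf
  by_cases hw0 : w = 0
  · refine ⟨0, 0, LinearMap.ext fun v => ?_⟩
    obtain ⟨c, hc⟩ := h ⟨f v, v, rfl⟩
    have := congrArg Subtype.val hc
    simpa [hw0] using this.symm
  · obtain ⟨χ, hχ⟩ : ∃ χ : Module.Dual K W, χ w ≠ 0 := by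
      by_contra! h0
      exact hw0 ((Module.forall_dual_apply_eq_zero_iff K w).1 h0)
    refine ⟨(χ w)⁻¹ • χ ∘ₗ f, w, LinearMap.ext fun v => ?_⟩
    obtain ⟨c, hc⟩ := h ⟨f v, v, rfl⟩
    have hc' : c • w = f v := congrArg Subtype.val hc
    simp only [LinearMap.smulRight_apply, LinearMap.smul_apply, LinearMap.comp_apply, ← hc',
      map_smul, smul_eq_mul]
    congr 1
    field_simp

theorem exists_eq_smulRight_of_formRank_le_one {f : V →ₗ[K] V' →ₗ[K] K} (hf : formRank f ≤ 1) :
    ∃ (φ : Module.Dual K V) (ψ : Module.Dual K V'), f = φ.smulRight ψ :=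
  exists_eq_smulRight_of_finrank_range_le_one ((formRank_eq_finrank_range f).symm.trans_le hf)

theorem exists_apply_eq_zero_and_ne_zero {φ₁ φ₂ : Module.Dual K V} (h : ∀ c : K, φ₂ ≠ c • φ₁) :
    ∃ v, φ₁ v = 0 ∧ φ₂ v ≠ 0 := by
  by_contra! hv
  have := mem_span_of_iInf_ker_le_ker (L := fun _ : Unit => φ₁) (K := φ₂)
    (by rw [iInf_const]; exact fun v h0 => hv v h0)
  rw [Set.range_const, Submodule.mem_span_singleton] at this
  obtain ⟨c, hc⟩ := this
  exact h c hc.symm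

/-- If two rank-one forms have a rank-one sum, their left or their right factors are proportional. A
vector killed by `φ₁` but not by `φ₂` shows that `ψ₂` is a multiple of `ψ`; exchanging the roles
compares `ψ₁` with `ψ`. -/
theorem exists_smul_eq_of_smulRight_add {φ φ₁ φ₂ : Module.Dual K V} {ψ ψ₁ ψ₂ : Module.Dual K V'}
    (h : φ₁.smulRight ψ₁ + φ₂.smulRight ψ₂ = φ.smulRight ψ)
    (h₁ : φ₁ ≠ 0) (h₂ : ∀ c : K, φ₂ ≠ c • φ₁) (hψ₁ : ψ₁ ≠ 0) : ∃ c : K, ψ₂ = c • ψ₁ := by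
  have h₂' : ∀ c : K, φ₁ ≠ c • φ₂ := by
    rintro c rfl
    have hc : c ≠ 0 := by rintro rfl; simp at h₁
    exact h₂ c⁻¹ (by rw [smul_smul, inv_mul_cancel₀ hc, one_smul])
  obtain ⟨v, hv1, hv2⟩ := exists_apply_eq_zero_and_ne_zero h₂
  obtain ⟨w, hw1, hw2⟩ := exists_apply_eq_zero_and_ne_zero h₂'
  have hv := LinearMap.congr_fun h v
  have hw := LinearMap.congr_fun h w
  simp only [LinearMap.add_apply, LinearMap.smulRight_apply, hv1, hw1, zero_smul, zero_add,
    add_zero] at hv hw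
  have hw0 : φ w ≠ 0 := by
    intro h0
    rw [h0, zero_smul] at hw
    exact (smul_ne_zero hw2 hψ₁) hw
  refine ⟨(φ₂ v)⁻¹ * φ v * (φ w)⁻¹ * φ₁ w, ?_⟩
  rw [← smul_smul, hw, smul_smul, inv_mul_cancel_right₀ hw0, ← smul_smul, ← hv, smul_smul,
    inv_mul_cancel₀ hv2, one_smul]

theorem smulRight_ne_zero {φ : Module.Dual K V} {ψ : Module.Dual K V'} (hφ : φ ≠ 0) (hψ : ψ ≠ 0) :
    φ.smulRight ψ ≠ 0 := by
  intro h
  refine hφ (LinearMap.ext fun v => ?_)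
  have := LinearMap.congr_fun h v
  simpa [hψ] using this

theorem smulRight_left_injective {ψ : Module.Dual K V'} (hψ : ψ ≠ 0) {φ φ' : Module.Dual K V}
    (h : φ.smulRight ψ = φ'.smulRight ψ) : φ = φ' := by
  by_contra hne
  refine smulRight_ne_zero (sub_ne_zero.2 hne) hψ ?_
  ext v v'
  have := LinearMap.congr_fun (LinearMap.congr_fun h v) v'
  simpa [sub_mul, sub_eq_zero] using this

theorem smulRight_right_injective {φ : Module.Dual K V} (hφ : φ ≠ 0) {ψ ψ' : Module.Dual K V'}
    (h : φ.smulRight ψ = φ.smulRight ψ') : ψ = ψ' := by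
  by_contra hne
  refine smulRight_ne_zero hφ (sub_ne_zero.2 hne) ?_
  ext v v'
  have := LinearMap.congr_fun (LinearMap.congr_fun h v) v'
  simpa [mul_sub, sub_eq_zero] using this

theorem smulRight_add_right (φ : Module.Dual K V) (ψ ψ' : Module.Dual K V') :
    φ.smulRight (ψ + ψ') = φ.smulRight ψ + φ.smulRight ψ' := by
  ext; simp

theorem smulRight_add_left (φ φ' : Module.Dual K V) (ψ : Module.Dual K V') :
    (φ + φ').smulRight ψ = φ.smulRight ψ + φ'.smulRight ψ := by
  ext; simp [add_mul]

theorem smulRight_smul_right (c : K) (φ : Module.Dual K V) (ψ : Module.Dual K V') :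
    φ.smulRight (c • ψ) = c • φ.smulRight ψ := by
  ext; simp [mul_left_comm]

theorem smulRight_smul_left (c : K) (φ : Module.Dual K V) (ψ : Module.Dual K V') :
    (c • φ).smulRight ψ = c • φ.smulRight ψ := by
  ext; simp [mul_assoc]

theorem sum_coord_smulRight (f : V →ₗ[K] V' →ₗ[K] K) :
    f = ∑ i, ((Module.finBasis K V).coord i).smulRight (f (Module.finBasis K V i)) := by
  refine (Module.finBasis K V).ext fun i => ?_
  simp [LinearMap.sum_apply, Finsupp.single_apply]

end RankOne

/-! ### Semilinear maps of the dual space. -/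

section Duality

variable {K V : Type*} [Field K] [Finite K] [AddCommGroup V] [Module K V] [FiniteDimensional K V]

/-- Every injective semilinear map of the dual space is induced by a semilinear bijection. -/
theorem exists_addEquiv_of_semilinear_dual (θ : K ≃+* K) (Γ : Module.Dual K V → Module.Dual K V)
    (hadd : ∀ φ φ', Γ (φ + φ') = Γ φ + Γ φ') (hsmul : ∀ (c : K) φ, Γ (c • φ) = θ c • Γ φ)
    (hinj : Function.Injective Γ) :
    ∃ g : V ≃+ V, (∀ (c : K) v, g (c • v) = θ.symm c • g v) ∧ ∀ φ v, Γ φ v = θ (φ (g v)) := by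
  have hV : Finite V := Module.finite_of_finite K
  have hD : Finite (Module.Dual K V) := Module.finite_of_finite K
  -- `θ⁻¹ ∘ Γ` evaluated at `v` is a linear functional on the dual, hence evaluation at a vector,
  -- which is the image of `v` under `g`.
  let G : V → Module.Dual K (Module.Dual K V) := fun v =>
    { toFun := fun φ => θ.symm (Γ φ v)
      map_add' := fun φ φ' => by rw [hadd, LinearMap.add_apply, map_add]
      map_smul' := fun c φ => by
        rw [hsmul, LinearMap.smul_apply, smul_eq_mul, map_mul, θ.symm_apply_apply]; rfl }
  let g₀ : V → V := fun v => (Module.evalEquiv K V).symm (G v)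
  have hg₀ : ∀ φ v, φ (g₀ v) = θ.symm (Γ φ v) := fun φ v =>
    Module.apply_evalEquiv_symm_apply K V φ (G v)
  have hext : ∀ v w : V, (∀ φ : Module.Dual K V, φ v = φ w) → v = w := fun v w h => by
    rw [← sub_eq_zero, ← Module.forall_dual_apply_eq_zero_iff K]
    intro φ
    rw [map_sub, h, sub_self]
  let g₁ : V →+ V :=
    { toFun := g₀
      map_zero' := hext _ _ fun φ => by rw [hg₀, map_zero, map_zero, map_zero]
      map_add' := fun v w => hext _ _ fun φ => by
        rw [map_add, hg₀, hg₀, hg₀, map_add, map_add] }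
  have hg₁ : Function.Injective g₁ := by
    intro v w h
    refine hext _ _ fun φ => ?_
    obtain ⟨χ, rfl⟩ := (Finite.injective_iff_surjective.1 hinj) φ
    have := congrArg χ h
    change χ (g₀ v) = χ (g₀ w) at this
    rw [hg₀, hg₀] at this
    exact θ.symm.injective this
  refine ⟨AddEquiv.ofBijective g₁ ⟨hg₁, Finite.injective_iff_surjective.1 hg₁⟩, fun c v => ?_,
    fun φ v => ?_⟩
  · refine hext _ _ fun φ => ?_
    change φ (g₀ (c • v)) = φ (θ.symm c • g₀ v)
    rw [map_smul, hg₀, hg₀, map_smul, smul_eq_mul, map_mul, smul_eq_mul]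
  · change Γ φ v = θ (φ (g₀ v))
    rw [hg₀, θ.apply_symm_apply]

end Duality

/-! ### Rank-preserving transformations. -/

section RankPreservers

variable {K V V' : Type*} [Field K] [Finite K] [AddCommGroup V] [Module K V]
  [FiniteDimensional K V] [AddCommGroup V'] [Module K V'] [FiniteDimensional K V']
  {τ : (V →ₗ[K] V' →ₗ[K] K) ≃+ (V →ₗ[K] V' →ₗ[K] K)}

/-- The forms with left factor `φ` constitute a space whose image consists of forms of rank at most
one, so the image has a common left factor or a common right factor. A common right factor would
embed the dual of `V'` in that of `V`. -/
theorem exists_left_factor (hdim : Module.finrank K V < Module.finrank K V')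
    (hτ : ∀ (φ : Module.Dual K V) (ψ : Module.Dual K V'),
      ∃ (φ' : Module.Dual K V) (ψ' : Module.Dual K V'), τ (φ.smulRight ψ) = φ'.smulRight ψ')
    (φ : Module.Dual K V) :
    ∃ φ' : Module.Dual K V, ∀ ψ : Module.Dual K V', ∃ ψ' : Module.Dual K V',
      τ (φ.smulRight ψ) = φ'.smulRight ψ' := by
  by_cases hφ : φ = 0
  · exact ⟨0, fun ψ => ⟨0, by ext; simp [hφ]⟩⟩
  choose α β hαβ using hτ φ
  have hne : ∀ ψ, ψ ≠ 0 → α ψ ≠ 0 ∧ β ψ ≠ 0 := by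
    intro ψ hψ
    have h : τ (φ.smulRight ψ) ≠ 0 := by
      rw [Ne, map_eq_zero_iff τ τ.injective]
      exact smulRight_ne_zero hφ hψ
    rw [hαβ] at h
    constructor
    · intro h0; apply h; ext; simp [h0]
    · intro h0; apply h; ext; simp [h0]
  have hpar : ∀ ψ ψ', ψ ≠ 0 → ψ' ≠ 0 → (∀ c : K, α ψ' ≠ c • α ψ) → ∃ c : K, β ψ' = c • β ψ := by
    intro ψ ψ' h h' hc
    refine exists_smul_eq_of_smulRight_add (φ := α (ψ + ψ')) (ψ := β (ψ + ψ')) ?_ (hne ψ h).1 hc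
      (hne ψ h).2
    rw [← hαβ, ← hαβ, ← hαβ, ← map_add, smulRight_add_right]
  have hW : Nontrivial V' := Module.finrank_pos_iff.1 (lt_of_le_of_lt (Nat.zero_le _) hdim)
  obtain ⟨ψ₁, hψ₁⟩ := exists_ne (0 : Module.Dual K V')
  by_cases hall : ∀ ψ, ψ ≠ 0 → ∃ c : K, α ψ = c • α ψ₁
  · refine ⟨α ψ₁, fun ψ => ?_⟩
    by_cases hψ : ψ = 0
    · exact ⟨0, by ext; simp [hψ]⟩
    obtain ⟨c, hc⟩ := hall ψ hψ
    exact ⟨c • β ψ, by rw [hαβ, hc, smulRight_smul_left, smulRight_smul_right]⟩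
  · exfalso
    push Not at hall
    obtain ⟨ψ₂, hψ₂, h12⟩ := hall
    obtain ⟨c₂, hc₂⟩ := hpar ψ₁ ψ₂ hψ₁ hψ₂ h12
    -- As `α ψ₁` and `α ψ₂` are independent, `α ψ` fails to be proportional to at least one of them;
    -- `hpar` then ties `β ψ` to `β ψ₁`, possibly through `β ψ₂`.
    have hb : ∀ ψ, ∃ c : K, ψ = 0 ∨ β ψ = c • β ψ₁ := by
      intro ψ
      by_cases hψ : ψ = 0
      · exact ⟨0, Or.inl hψ⟩
      by_cases h1 : ∀ c : K, α ψ ≠ c • α ψ₁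
      · obtain ⟨c, hc⟩ := hpar ψ₁ ψ hψ₁ hψ h1
        exact ⟨c, Or.inr hc⟩
      · push Not at h1
        obtain ⟨c, hc⟩ := h1
        have h2 : ∀ d : K, α ψ ≠ d • α ψ₂ := by
          intro d hd
          have hd0 : d ≠ 0 := by
            rintro rfl
            exact (hne ψ hψ).1 (by rw [hd, zero_smul])
          refine h12 (d⁻¹ * c) ?_
          rw [← smul_smul, ← hc, hd, smul_smul, inv_mul_cancel₀ hd0, one_smul]
        obtain ⟨d, hd⟩ := hpar ψ₂ ψ hψ₂ hψ h2
        exact ⟨d * c₂, Or.inr (by rw [hd, hc₂, smul_smul])⟩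
    have hγ : ∀ ψ, ∃ γ : Module.Dual K V, τ (φ.smulRight ψ) = γ.smulRight (β ψ₁) := by
      intro ψ
      obtain ⟨c, h | h⟩ := hb ψ
      · exact ⟨0, by ext; simp [h]⟩
      · exact ⟨c • α ψ, by rw [hαβ, h, smulRight_smul_left, smulRight_smul_right]⟩
    choose γ hγ using hγ
    have hinj : Function.Injective γ := fun ψ ψ' h =>
      smulRight_right_injective hφ (τ.injective (by rw [hγ, hγ, h]))
    have hD : Finite (Module.Dual K V) := Module.finite_of_finite K
    have hcard := Nat.card_le_card_of_injective γ hinj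
    rw [Module.natCard_eq_pow_finrank (K := K) (V := Module.Dual K V),
      Module.natCard_eq_pow_finrank (K := K) (V := Module.Dual K V'),
      Subspace.dual_finrank_eq, Subspace.dual_finrank_eq,
      Nat.pow_le_pow_iff_right Finite.one_lt_card] at hcard
    exact absurd hcard (not_le.2 hdim)

/-- Rank preserving semilinear bijections of a space of bilinear forms on two spaces of different
dimensions come from semilinear bijections of the two spaces. -/
theorem IsRankAut.isProductAut (hdim : Module.finrank K V < Module.finrank K V')
    (hV : 0 < Module.finrank K V) (h : IsRankAut τ) : IsProductAut τ := by
  obtain ⟨⟨θ, hθ⟩, hrank⟩ := h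
  have hV0 : Nontrivial V := Module.finrank_pos_iff.1 hV
  have hV0' : Nontrivial V' := Module.finrank_pos_iff.1 (hV.trans hdim)
  have hD : Finite (Module.Dual K V') := Module.finite_of_finite K
  choose Φ T hT using exists_left_factor (τ := τ) hdim fun φ ψ =>
    exists_eq_smulRight_of_formRank_le_one (by
      rw [hrank]; exact formRank_smulRight_le_one φ ψ)
  have hne : ∀ φ ψ, φ ≠ 0 → ψ ≠ 0 → Φ φ ≠ 0 ∧ T φ ψ ≠ 0 := by
    intro φ ψ hφ hψ
    have h : τ (φ.smulRight ψ) ≠ 0 := by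
      rw [Ne, map_eq_zero_iff τ τ.injective]
      exact smulRight_ne_zero hφ hψ
    rw [hT] at h
    constructor
    · intro h0; apply h; ext; simp [h0]
    · intro h0; apply h; ext; simp [h0]
  obtain ⟨ψ₁, hψ₁⟩ := exists_ne (0 : Module.Dual K V')
  have hΦ : ∀ φ, φ ≠ 0 → Φ φ ≠ 0 := fun φ hφ => (hne φ ψ₁ hφ hψ₁).1
  have hTinj : ∀ φ, φ ≠ 0 → Function.Injective (T φ) := fun φ hφ ψ ψ' h =>
    smulRight_right_injective hφ (τ.injective (by rw [hT, hT, h]))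
  obtain ⟨φ₀, hφ₀⟩ := exists_ne (0 : Module.Dual K V)
  have hTadd : ∀ ψ ψ', T φ₀ (ψ + ψ') = T φ₀ ψ + T φ₀ ψ' := fun ψ ψ' =>
    smulRight_right_injective (hΦ φ₀ hφ₀) (by
      rw [← hT, smulRight_add_right, map_add, hT, hT, smulRight_add_right])
  have hTsmul : ∀ (c : K) ψ, T φ₀ (c • ψ) = θ c • T φ₀ ψ := fun c ψ =>
    smulRight_right_injective (hΦ φ₀ hφ₀) (by
      rw [← hT, smulRight_smul_right, hθ, hT, smulRight_smul_right])
  -- The right factor of the image can be taken to depend on `ψ` alone. For `φ` not proportional to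
  -- `φ₀`, this comes from the rank of the image of `(φ₀ + φ) ⊗ ψ`.
  have hγ : ∀ (φ : Module.Dual K V) (ψ : Module.Dual K V'), ∃ γ : Module.Dual K V,
      τ (φ.smulRight ψ) = γ.smulRight (T φ₀ ψ) := by
    intro φ ψ
    by_cases hψ : ψ = 0
    · exact ⟨0, by ext; simp [hψ]⟩
    by_cases hpar : ∃ c : K, φ = c • φ₀
    · obtain ⟨c, rfl⟩ := hpar
      exact ⟨θ c • Φ φ₀, by rw [smulRight_smul_left, hθ, hT, smulRight_smul_left]⟩
    · push Not at hpar
      have hφ : φ ≠ 0 := by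
        rintro rfl
        exact hpar 0 (by simp)
      have hpar' : ∀ c : K, Φ φ ≠ c • Φ φ₀ := by
        intro c hc
        have hc0 : c ≠ 0 := by
          rintro rfl
          exact hΦ φ hφ (by rw [hc, zero_smul])
        -- Proportional left factors would make the images of `φ ⊗ ψ` and of some `φ₀ ⊗ ψ'`
        -- coincide.
        obtain ⟨ψ', hψ'⟩ := (Finite.injective_iff_surjective.1 (hTinj φ₀ hφ₀)) (c • T φ ψ)
        have heq : φ.smulRight ψ = φ₀.smulRight ψ' := τ.injective (by
          rw [hT, hT, hψ', hc, smulRight_smul_left, smulRight_smul_right])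
        obtain ⟨v, hv1, hv2⟩ := exists_apply_eq_zero_and_ne_zero hpar
        have := LinearMap.congr_fun heq v
        simp only [LinearMap.smulRight_apply, hv1, zero_smul] at this
        exact smul_ne_zero hv2 hψ this
      obtain ⟨c, hc⟩ := exists_smul_eq_of_smulRight_add (φ := Φ (φ₀ + φ)) (ψ := T (φ₀ + φ) ψ)
        (by rw [← hT φ₀ ψ, ← hT φ ψ, ← hT, ← map_add, smulRight_add_left]) (hΦ φ₀ hφ₀) hpar'
        (hne φ₀ ψ hφ₀ hψ).2
      exact ⟨c • Φ φ, by rw [hT, hc, smulRight_smul_left, smulRight_smul_right]⟩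
  choose γ hγ using hγ
  -- The left factor depends on `φ` alone: expand the image of `φ ⊗ (ψ₁ + ψ)` and compare
  -- coefficients of the independent functionals `T φ₀ ψ₁` and `T φ₀ ψ`.
  have hγ1 : ∀ φ ψ, ψ ≠ 0 → γ φ ψ = γ φ ψ₁ := by
    intro φ ψ hψ
    by_cases hpar : ∃ c : K, ψ = c • ψ₁
    · obtain ⟨c, rfl⟩ := hpar
      refine smulRight_left_injective (hne φ₀ _ hφ₀ hψ).2 ?_
      rw [← hγ, smulRight_smul_right, hθ, hγ, hTsmul, smulRight_smul_right]
    · push Not at hpar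
      have hpar' : ∀ c : K, T φ₀ ψ ≠ c • T φ₀ ψ₁ := by
        intro c hc
        refine hpar (θ.symm c) (hTinj φ₀ hφ₀ ?_)
        rw [hc, hTsmul, θ.apply_symm_apply]
      have hsum : ∀ v, (γ φ (ψ₁ + ψ) v - γ φ ψ₁ v) • T φ₀ ψ₁ +
          (γ φ (ψ₁ + ψ) v - γ φ ψ v) • T φ₀ ψ = 0 := by
        intro v
        have := hγ φ (ψ₁ + ψ)
        rw [smulRight_add_right, map_add, hγ, hγ, hTadd] at this
        ext v'
        have := LinearMap.congr_fun (LinearMap.congr_fun this v) v'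
        simp only [LinearMap.add_apply, LinearMap.smulRight_apply, LinearMap.smul_apply,
          smul_eq_mul, LinearMap.zero_apply] at this ⊢
        linear_combination -this
      ext v
      have h2 : γ φ (ψ₁ + ψ) v - γ φ ψ v = 0 := by
        by_contra h0
        refine hpar' (-(γ φ (ψ₁ + ψ) v - γ φ ψ v)⁻¹ * (γ φ (ψ₁ + ψ) v - γ φ ψ₁ v)) ?_
        rw [← smul_smul, eq_neg_of_add_eq_zero_left (hsum v), smul_neg, neg_smul, neg_neg,
          smul_smul, inv_mul_cancel₀ h0, one_smul]
      have h1 := hsum v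
      rw [h2, zero_smul, add_zero, smul_eq_zero, or_iff_left (hne φ₀ ψ₁ hφ₀ hψ₁).2] at h1
      rw [← sub_eq_zero.1 h2, sub_eq_zero.1 h1]
  have hγ2 : ∀ φ ψ, τ (φ.smulRight ψ) = (γ φ ψ₁).smulRight (T φ₀ ψ) := by
    intro φ ψ
    by_cases hψ : ψ = 0
    · rw [hγ, hψ]
      have hT0 : T φ₀ 0 = 0 := by simpa using hTadd 0 0
      ext
      simp [hT0]
    · rw [hγ, hγ1 φ ψ hψ]
  have hTψ₁ := (hne φ₀ ψ₁ hφ₀ hψ₁).2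
  obtain ⟨g, hg, hgφ⟩ := exists_addEquiv_of_semilinear_dual θ (fun φ => γ φ ψ₁)
    (fun φ φ' => smulRight_left_injective hTψ₁ (by
      rw [← hγ2, smulRight_add_left, map_add, hγ2, hγ2, smulRight_add_left]))
    (fun c φ => smulRight_left_injective hTψ₁ (by
      rw [← hγ2, smulRight_smul_left, hθ, hγ2, smulRight_smul_left]))
    (fun φ φ' h => smulRight_left_injective hψ₁ (τ.injective (by
      rw [hγ2, hγ2]; exact congrArg (fun χ => χ.smulRight (T φ₀ ψ₁)) h)))
  obtain ⟨g', hg', hgψ⟩ := exists_addEquiv_of_semilinear_dual θ (T φ₀) hTadd hTsmul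
    (hTinj φ₀ hφ₀)
  refine ⟨θ, g, g', hg, hg', fun f v v' => ?_⟩
  conv_lhs => rw [sum_coord_smulRight f, map_sum]
  conv_rhs => rw [sum_coord_smulRight f]
  simp only [LinearMap.sum_apply, map_sum, hγ2, LinearMap.smulRight_apply, LinearMap.smul_apply,
    smul_eq_mul, map_mul, hgφ, hgψ]

/-- Product transformations preserve the rank. -/
theorem IsProductAut.isRankAut (h : IsProductAut τ) : IsRankAut τ := by
  obtain ⟨θ, g, g', hg, hg', hτ⟩ := h
  refine ⟨⟨θ, fun c f => ?_⟩, fun f => ?_⟩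
  · ext v v'
    simp [hτ]
  · have hfin : Finite V := Module.finite_of_finite K
    have hcard : Nat.card (LinearMap.ker (τ f)) = Nat.card (LinearMap.ker f) := by
      refine Nat.card_congr (g.toEquiv.subtypeEquiv fun v => ?_)
      simp only [LinearMap.mem_ker]
      constructor
      · intro hv
        ext v'
        have := hτ f v (g'.symm v')
        rw [hv, LinearMap.zero_apply, AddEquiv.apply_symm_apply, eq_comm,
          map_eq_zero_iff θ θ.injective] at this
        exact this
      · intro hv
        ext v'
        rw [hτ]
        change θ (f (g.toEquiv v) (g' v')) = 0
        rw [hv, LinearMap.zero_apply, map_zero]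
    rw [Module.natCard_eq_pow_finrank (K := K) (V := LinearMap.ker (τ f)),
      Module.natCard_eq_pow_finrank (K := K) (V := LinearMap.ker f)] at hcard
    rw [formRank, formRank, Nat.pow_right_injective (Finite.one_lt_card (α := K)) hcard]

end RankPreservers

/-! ### The supports of the coefficients of `A` and `B`. -/

section Support

variable {K L : Type*} [Field K] [Fintype K] [Field L] [Finite L] [Algebra K L]
  {m n : ℕ} [NeZero m] {κ : ℤ}

variable (K) in
/-- The coefficient of `γ ^ (q ^ (κ l))` in the coefficient of `x ^ (q ^ (κ d))` in
`B (γ A(x) + η γ ^ (q ^ (κ w)) A(x) ^ (q ^ (κ t)))`, where `A` and `B` are the linearized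
polynomials with coefficients `a` and `b`. -/
def mixedCoeff (κ : ℤ) (bar : ZMod n →+* ZMod m) (a : ZMod m → L) (b : ZMod n → L) (t : ℕ) (η : L)
    (w : ZMod n) (d : ZMod m) (l : ZMod n) : L :=
  b l * twist K κ l (a (d - bar l)) +
    b (l - w) * twist K κ (l - w) η * twist K κ (l - w + (t : ZMod n)) (a (d - bar (l - w) - t))

variable {bar : ZMod n →+* ZMod m} {a : ZMod m → L} {b : ZMod n → L} {t : ℕ} {η : L} {w : ZMod n}

/-- Two terms that sum to zero vanish together. This carries a non-zero pair `(a_i, b_l)` to another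
one, with `l` shifted by `w`. -/
theorem ne_zero_iff_of_mixedCoeff_eq_zero (hη : η ≠ 0) {d : ZMod m} {l : ZMod n}
    (h : mixedCoeff K κ bar a b t η w d l = 0) :
    (b l ≠ 0 ∧ a (d - bar l) ≠ 0) ↔ (b (l - w) ≠ 0 ∧ a (d - bar (l - w) - t) ≠ 0) := by
  have h1 : b l * twist K κ l (a (d - bar l)) ≠ 0 ↔ (b l ≠ 0 ∧ a (d - bar l) ≠ 0) := by
    simp
  have h2 : b (l - w) * twist K κ (l - w) η * twist K κ (l - w + (t : ZMod n)) (a (d - bar (l - w) - t)) ≠ 0 ↔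
      (b (l - w) ≠ 0 ∧ a (d - bar (l - w) - t) ≠ 0) := by
    simp [hη]
  rw [← h1, ← h2, eq_neg_of_add_eq_zero_left h, neg_ne_zero]

theorem exists_natCast_eq (D : ZMod m) : ∃ v : ℕ, v < m ∧ D = v :=
  ⟨D.val, ZMod.val_lt D, (ZMod.natCast_zmod_val D).symm⟩

theorem natCast_pred : ((m - 1 : ℕ) : ZMod m) = -1 := by
  rw [Nat.cast_sub (Nat.one_le_iff_ne_zero.2 (NeZero.ne m))]
  simp

/-- Put `D = i + bar l` for a non-zero pair. By `hE0`, all of `D + 1, …, D + t - 1` lie in `{0, …,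
t}` modulo `m`, so `D ∈ {0, 1, -1}`. If `D = ±1`, the mixed relation produces a pair with sum `±(t -
bar w + 1)`, which the hypotheses keep out of that set. -/
theorem add_eq_zero_of_two_le (hη : η ≠ 0) (ht : 2 ≤ t) (htm : t + 2 ≤ m)
    (h0 : (t : ZMod m) - bar w ≠ 0) (h1 : (t : ZMod m) - bar w ≠ -1)
    (h2 : (t : ZMod m) - bar w ≠ -2)
    (hE0 : ∀ j : ℕ, 1 ≤ j → j < t → ∀ d : ZMod m, t < d.val → ∀ l, b l ≠ 0 → a (d - bar l - j) = 0)
    (hE1 : ∀ d : ZMod m, t < d.val → ∀ l, mixedCoeff K κ bar a b t η w d l = 0)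
    {i : ZMod m} {l : ZMod n} (hi : a i ≠ 0) (hl : b l ≠ 0) : i + bar l = 0 := by
  have key : ∀ {i : ZMod m} {l : ZMod n}, a i ≠ 0 → b l ≠ 0 →
      i + bar l = 0 ∨ i + bar l = 1 ∨ i + bar l = -1 := by
    intro i l hi hl
    by_contra! hD
    obtain ⟨hD0, hD1, hD2⟩ := hD
    obtain ⟨v, hv, hvD⟩ := exists_natCast_eq (i + bar l)
    have hi' : i = v - bar l := by rw [← hvD]; ring
    rw [hvD] at hD0 hD1 hD2
    have hv0 : v ≠ 0 := by rintro rfl; simp at hD0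
    have hv1 : v ≠ 1 := by rintro rfl; simp at hD1
    have hv2 : v ≠ m - 1 := by rintro rfl; exact hD2 natCast_pred
    by_cases htv : t ≤ v
    · refine hi ?_
      have := hE0 1 le_rfl (by omega) ((v + 1 : ℕ) : ZMod m)
        (by rw [ZMod.val_cast_of_lt (by omega)]; omega) l hl
      rw [← this, hi']
      congr 1
      push_cast
      ring
    · refine hi ?_
      have := hE0 (t + 1 - v) (by omega) (by omega) ((t + 1 : ℕ) : ZMod m)
        (by rw [ZMod.val_cast_of_lt (by omega)]; omega) l hl
      rw [← this, hi', Nat.cast_sub (by omega)]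
      congr 1
      ring
  obtain h | h | h := key hi hl
  · exact h
  · exfalso
    have hd : t < ((t + 1 : ℕ) : ZMod m).val := by rw [ZMod.val_cast_of_lt (by omega)]; omega
    -- At `d = t + 1` and index `l + w`, the second term of the mixed coefficient is the one
    -- containing `b l` and `a i`.
    have hi' : i = ((t + 1 : ℕ) : ZMod m) - bar (l + w - w) - t := by
      rw [add_sub_cancel_right, eq_sub_of_add_eq h]
      push_cast
      ring
    have := (ne_zero_iff_of_mixedCoeff_eq_zero hη (hE1 _ hd (l + w))).2
      ⟨by rwa [add_sub_cancel_right], by rwa [← hi']⟩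
    have hs : ((t + 1 : ℕ) : ZMod m) - bar (l + w) + bar l = t - bar w + 1 := by
      rw [map_add]; push_cast; ring
    have h3 := key this.2 hl
    rw [hs] at h3
    obtain h3 | h3 | h3 := h3
    · exact h1 (eq_neg_of_add_eq_zero_left h3)
    · exact h0 (by linear_combination h3)
    · exact h2 (by linear_combination h3)
  · exfalso
    have hd : t < (-1 : ZMod m).val := by
      rw [← natCast_pred, ZMod.val_cast_of_lt (by omega)]; omega
    have := (ne_zero_iff_of_mixedCoeff_eq_zero hη (hE1 _ hd l)).1
      ⟨hl, by rwa [← eq_sub_of_add_eq h]⟩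
    have hs : -1 - bar (l - w) - t + bar l = -(t - bar w) - 1 := by
      rw [map_sub]; ring
    have h3 := key this.2 hl
    rw [hs] at h3
    obtain h3 | h3 | h3 := h3
    · exact h1 (by linear_combination -h3)
    · exact h2 (by linear_combination -h3)
    · exact h0 (by linear_combination -h3)

/-- Dividing the mixed relation by `b l` gives a recursion for `a` with one constant `c`, valid for
all but the two indices `-bar l` and `1 - bar l`. -/
theorem exists_eq_mul_twist_of_mixedCoeff (hn : Module.finrank K L = n)
    (hE1 : ∀ d : ZMod m, d ≠ 0 → d ≠ 1 → ∀ l, mixedCoeff K κ bar a b 1 η w d l = 0)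
    {l : ZMod n} (hl : b l ≠ 0) :
    ∃ c : L, ∀ i, i + bar l ≠ 0 → i + bar l ≠ 1 →
      a i = c * twist K κ (1 - w) (a (i - (1 - bar w))) := by
  refine ⟨twist K κ (-l) (-(b l)⁻¹ * b (l - w) * twist K κ (l - w) η), fun i h0 h1 => ?_⟩
  have h := hE1 _ h0 h1 l
  rw [mixedCoeff, add_sub_cancel_right,
    show i + bar l - bar (l - w) - (1 : ℕ) = i - (1 - bar w) by rw [map_sub]; push_cast; ring] at h
  have h' : twist K κ l (a i) = -(b l)⁻¹ * b (l - w) * twist K κ (l - w) η *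
      twist K κ (l - w + ((1 : ℕ) : ZMod n)) (a (i - (1 - bar w))) := by
    field_simp
    linear_combination h
  have := congrArg (twist K κ (-l)) h'
  rw [twist_neg_apply_twist hn, map_mul, ← twist_add hn] at this
  rw [this]
  congr 3
  push_cast
  ring

/-- A pair with non-zero sum yields two indices `l₁` and `l₁ - w` in the support of `b`. Each gives
a recursion for `a` with two exceptional indices; the exceptions are disjoint and the constants
agree, so the recursion holds everywhere, against `hA`. -/
theorem add_eq_zero_of_one (hn : Module.finrank K L = n) (hη : η ≠ 0) (hm : 4 ≤ m)
    (h0 : 1 - bar w ≠ 0) (h1 : 1 - bar w ≠ 1) (h1' : 1 - bar w ≠ -1)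
    (h2 : 1 - bar w ≠ 2) (h2' : 1 - bar w ≠ -2)
    (hE1 : ∀ d : ZMod m, 1 < d.val → ∀ l, mixedCoeff K κ bar a b 1 η w d l = 0)
    (hA : ∀ c : L, ∃ i, a i ≠ c * twist K κ (1 - w) (a (i - (1 - bar w))))
    {i : ZMod m} {l : ZMod n} (hi : a i ≠ 0) (hl : b l ≠ 0) : i + bar l = 0 := by
  have hE1' : ∀ d : ZMod m, d ≠ 0 → d ≠ 1 → ∀ l, mixedCoeff K κ bar a b 1 η w d l = 0 := by
    intro d hd0 hd1 l
    refine hE1 d ?_ l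
    obtain ⟨v, hv, rfl⟩ := exists_natCast_eq d
    have hv0 : v ≠ 0 := by rintro rfl; simp at hd0
    have hv1 : v ≠ 1 := by rintro rfl; simp at hd1
    rw [ZMod.val_cast_of_lt hv]
    omega
  have hstep : ∀ (v : ℕ), 1 ≤ v → v + 1 < m → ∀ l,
      (b l ≠ 0 ∧ a ((v + 1 : ℕ) - bar l) ≠ 0) ↔ (b (l - w) ≠ 0 ∧ a (v - bar (l - w)) ≠ 0) := by
    intro v hv hvm l
    rw [ne_zero_iff_of_mixedCoeff_eq_zero hη (hE1 ((v + 1 : ℕ) : ZMod m)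
      (by rw [ZMod.val_cast_of_lt hvm]; omega) l)]
    rw [show ((v + 1 : ℕ) : ZMod m) - bar (l - w) - (1 : ℕ) = v - bar (l - w) by push_cast; ring]
  -- Shifting `l` by `w` changes the sum of a pair by one, so all non-zero sums occur or none does.
  have hchain : ∀ v : ℕ, 1 ≤ v → v < m →
      ((∃ l, b l ≠ 0 ∧ a (v - bar l) ≠ 0) ↔ ∃ l, b l ≠ 0 ∧ a ((1 : ℕ) - bar l) ≠ 0) := by
    intro v hv
    induction v, hv using Nat.le_induction with
    | base => exact fun _ => Iff.rfl
    | succ v hv ih =>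
      intro hvm
      rw [← ih (by omega)]
      constructor
      · rintro ⟨l, hl⟩
        exact ⟨l - w, (hstep v hv hvm l).1 hl⟩
      · rintro ⟨l, hl⟩
        exact ⟨l + w, (hstep v hv hvm (l + w)).2 (by rwa [add_sub_cancel_right])⟩
  by_contra hD
  obtain ⟨v, hv, hvD⟩ := exists_natCast_eq (i + bar l)
  have hv0 : v ≠ 0 := by rintro rfl; simp [hvD] at hD
  obtain ⟨l₁, hl₁, ha₁⟩ := (hchain 3 (by omega) (by omega)).2
    ((hchain v (by omega) hv).1 ⟨l, hl, by rwa [← hvD, add_sub_cancel_right]⟩)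
  have hl₂ := ((hstep 2 (by omega) (by omega) l₁).1 ⟨hl₁, ha₁⟩).1
  obtain ⟨c₁, hc₁⟩ := exists_eq_mul_twist_of_mixedCoeff hn hE1' hl₁
  obtain ⟨c₂, hc₂⟩ := exists_eq_mul_twist_of_mixedCoeff hn hE1' hl₂
  have h30 : ((3 : ℕ) : ZMod m) ≠ 0 := by
    rw [Ne, ZMod.natCast_eq_zero_iff]
    exact fun h => absurd (Nat.le_of_dvd (by omega) h) (by omega)
  have h20 : ((2 : ℕ) : ZMod m) ≠ 0 := by
    rw [Ne, ZMod.natCast_eq_zero_iff]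
    exact fun h => absurd (Nat.le_of_dvd (by omega) h) (by omega)
  push_cast at h30 h20 ha₁
  have e₁ := hc₁ (3 - bar l₁) (by rw [sub_add_cancel]; exact h30)
    (by rw [sub_add_cancel]; exact fun h => h20 (by linear_combination h))
  -- The index `3 - bar l₁` is exceptional for neither recursion and `a` does not vanish there; this
  -- identifies the two constants.
  have e₂ := hc₂ (3 - bar l₁)
    (by rw [map_sub]; exact fun h => h2' (by linear_combination h))
    (by rw [map_sub]; exact fun h => h1' (by linear_combination h))
  have hX : twist K κ (1 - w) (a (3 - bar l₁ - (1 - bar w))) ≠ 0 := by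
    intro h
    rw [h, mul_zero] at e₁
    exact ha₁ e₁
  have hcc : c₁ = c₂ := mul_right_cancel₀ hX (e₁.symm.trans e₂)
  obtain ⟨i, hi⟩ := hA c₁
  by_cases hi0 : i + bar l₁ = 0
  · refine hi (hcc ▸ hc₂ i ?_ ?_)
    · rw [map_sub]; exact fun h => h1 (by linear_combination h - hi0)
    · rw [map_sub]; exact fun h => h2 (by linear_combination h - hi0)
  by_cases hi1 : i + bar l₁ = 1
  · refine hi (hcc ▸ hc₂ i ?_ ?_)
    · rw [map_sub]; exact fun h => h0 (by linear_combination h - hi1)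
    · rw [map_sub]; exact fun h => h1 (by linear_combination h - hi1)
  exact hi (hc₁ i hi0 hi1)

/-- Of the four terms in the equation `hE`, two have index sums `t` and `-t` and vanish by `hsupp`.
In the others the index of `a` must be `i₀` unless `b` vanishes. -/
theorem coeff_relation_of_support (hn : Module.finrank K L = n) (hη : η ≠ 0)
    (ht : (t : ZMod m) ≠ 0) {η' : L} {w' : ZMod n}
    (hsupp : ∀ i l, a i ≠ 0 → b l ≠ 0 → i + bar l = 0)
    (hE : ∀ l, mixedCoeff K κ bar a b t η w t l =
      η' * twist K κ w' (mixedCoeff K κ bar a b t η w 0 (l - w')))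
    {i₀ : ZMod m} (hi₀ : a i₀ ≠ 0) {l₀ : ZMod n} (hl₀ : b l₀ ≠ 0) :
    bar w = bar w' ∧ ∀ l, b (l - w) * twist K κ (l - w) η * twist K κ (l - w + (t : ZMod n)) (a i₀) =
      η' * twist K κ w' (b (l - w')) * twist K κ l (a i₀) := by
  have hprod : ∀ l i, i + bar l ≠ 0 → b l = 0 ∨ a i = 0 := by
    intro l i h
    by_contra! hh
    exact h (hsupp i l hh.2 hh.1)
  have h : ∀ l, b (l - w) * twist K κ (l - w) η * twist K κ (l - w + (t : ZMod n)) (a (-bar (l - w))) =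
      η' * twist K κ w' (b (l - w')) * twist K κ l (a (-bar (l - w'))) := by
    intro l
    have := hE l
    have z1 : b l * twist K κ l (a (t - bar l)) = 0 := by
      rcases hprod l (t - bar l) (by rwa [sub_add_cancel]) with h | h <;> simp [h]
    have z2 : b (l - w' - w) * twist K κ (l - w' - w) η *
        twist K κ (l - w' - w + (t : ZMod n)) (a (0 - bar (l - w' - w) - t)) = 0 := by
      rcases hprod (l - w' - w) (0 - bar (l - w' - w) - t)
        (by rw [zero_sub, neg_sub_left, neg_add, neg_add_cancel_right]; exact neg_ne_zero.2 ht)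
        with h | h <;> rw [h] <;> simp
    rw [mixedCoeff, mixedCoeff, z1, z2, zero_add, add_zero, map_mul, ← twist_add hn,
      add_sub_cancel, zero_sub, ← mul_assoc, sub_right_comm, sub_self, zero_sub] at this
    exact this
  have hb : ∀ l, b l ≠ 0 → -bar l = i₀ := fun l hl =>
    (eq_neg_of_add_eq_zero_left (hsupp i₀ l hi₀ hl)).symm
  have hl : ∀ l, b (l - w) * twist K κ (l - w) η * twist K κ (l - w + (t : ZMod n)) (a i₀) =
      η' * twist K κ w' (b (l - w')) * twist K κ l (a i₀) := by
    intro l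
    have h1 : b (l - w) * twist K κ (l - w) η * twist K κ (l - w + (t : ZMod n)) (a (-bar (l - w))) =
        b (l - w) * twist K κ (l - w) η * twist K κ (l - w + (t : ZMod n)) (a i₀) := by
      by_cases hz : b (l - w) = 0
      · simp [hz]
      · rw [hb _ hz]
    have h2 : η' * twist K κ w' (b (l - w')) * twist K κ l (a (-bar (l - w'))) =
        η' * twist K κ w' (b (l - w')) * twist K κ l (a i₀) := by
      by_cases hz : b (l - w') = 0
      · simp [hz]
      · rw [hb _ hz]
    rw [← h1, ← h2, h]
  refine ⟨?_, hl⟩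
  -- The left side of the relation at `l₀ + w` is non-zero, so `l₀` and `l₀ + w - w'` both lie in
  -- the support of `b`, which is a single class modulo `m`.
  have hne : b (l₀ + w - w') ≠ 0 := by
    intro hz
    have := hl (l₀ + w)
    rw [hz, map_zero, mul_zero, zero_mul, add_sub_cancel_right] at this
    exact mul_ne_zero (mul_ne_zero hl₀ (by simpa using hη)) (by simpa using hi₀) this
  have e1 := hsupp _ _ hi₀ hne
  have e2 := hsupp _ _ hi₀ hl₀
  rw [map_sub, map_add] at e1
  linear_combination e1 - e2

end Support

/-! ### The code in terms of coefficients. -/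

section CodeMembership

theorem sum_zmod_eq_sum_range {M : Type*} [AddCommMonoid M] {m : ℕ} [NeZero m] (g : ZMod m → M) :
    ∑ i, g i = ∑ j ∈ Finset.range m, g (j : ZMod m) := by
  refine Finset.sum_nbij' (fun i => i.val) (fun j => (j : ZMod m)) ?_ ?_ ?_ ?_ ?_
  · exact fun i _ => Finset.mem_range.2 (ZMod.val_lt i)
  · exact fun j _ => Finset.mem_univ _
  · exact fun i _ => ZMod.natCast_zmod_val i
  · exact fun j hj => ZMod.val_cast_of_lt (Finset.mem_range.1 hj)
  · exact fun i _ => by rw [ZMod.natCast_zmod_val]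

theorem sum_fin_eq_sum_zmod {M : Type*} [AddCommMonoid M] {n : ℕ} [NeZero n] (g : ZMod n → M) :
    ∑ i : Fin n, g (i.val : ZMod n) = ∑ z, g z := by
  rw [sum_zmod_eq_sum_range, Fin.sum_univ_eq_sum_range (fun j => g (j : ZMod n))]

variable {K F L : Type*} [Field K] [Fintype K] [Field F] [Finite F] [Field L] [Finite L]
  [Algebra K F] [Algebra K L] [Algebra F L] [IsScalarTower K F L]
  {m n : ℕ} [NeZero m] {κ : ℤ}

theorem twist_neg_left (hn : Module.finrank K L = n) (z : ZMod n) :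
    (twist K (-κ) z : L ≃ₐ[K] L) = twist K κ (-z) := by
  obtain ⟨z, rfl⟩ := ZMod.intCast_surjective z
  rw [← Int.cast_neg, twist_intCast hn, twist_intCast hn, neg_mul, mul_neg]

theorem twistEmb_natCast (hm : Module.finrank K F = m) (hn : Module.finrank K L = n) (hmn : m ∣ n)
    (j : ℕ) (x : F) :
    twistEmb K F L κ (j : ZMod m) x = twist K κ (j : ZMod n) (algebraMap F L x) := by
  rw [twist_algebraMap hm hn hmn, map_natCast, twistEmb_apply]

variable (K) in
/-- The coefficients `c` satisfy the equations that define a twisted Gabidulin code. -/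
def IsTwistedCoeff (κ : ℤ) (t : ℕ) (η : L) (w : ZMod n) (c : ZMod m → L) : Prop :=
  (∀ i, t < i.val → c i = 0) ∧ c t = η * twist K κ w (c 0)

theorem linPoly_apply_of_vanish (hm : Module.finrank K F = m) (hn : Module.finrank K L = n)
    (hmn : m ∣ n) {t : ℕ} (ht : 1 ≤ t) (htm : t < m) {c : ZMod m → L}
    (hc : ∀ i, t < i.val → c i = 0) (x : F) :
    (linPoly κ c : F →ₗ[K] L) x = c 0 * algebraMap F L x +
      c t * twist K κ (t : ZMod n) (algebraMap F L x) +
      ∑ j ∈ Finset.Icc 1 (t - 1), c (j : ZMod m) * twist K κ (j : ZMod n) (algebraMap F L x) := by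
  rw [linPoly_apply, sum_zmod_eq_sum_range]
  simp only [twistEmb_natCast hm hn hmn]
  have hsub : insert 0 (insert t (Finset.Icc 1 (t - 1))) ⊆ Finset.range m := by
    intro j
    simp only [Finset.mem_insert, Finset.mem_Icc, Finset.mem_range]
    omega
  rw [← Finset.sum_subset hsub, Finset.sum_insert, Finset.sum_insert, ← add_assoc, Nat.cast_zero,
    Nat.cast_zero, twist_zero]
  · simp only [Finset.mem_Icc]
    omega
  · simp only [Finset.mem_insert, Finset.mem_Icc]
    omega
  · intro j hj hj'
    simp only [Finset.mem_insert, Finset.mem_Icc, Finset.mem_range] at hj hj'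
    rw [hc _ (by rw [ZMod.val_cast_of_lt hj]; omega), zero_mul]

/-- Moving the Frobenius power from `y` to `a x` under the trace inverts it; hence the choice `κ =
-k`. -/
theorem cyclicForm_apply_eq_trace_twist (hn : Module.finrank K L = n) (k j : ℕ) (a x y : L) :
    cyclicForm K L k j a x y =
      Algebra.trace K L (y * (twist K (-k) (j : ZMod n) a * twist K (-k) (j : ZMod n) x)) := by
  have h : (frobPow K ((k * j : ℕ) : ℤ) : L ≃ₐ[K] L) = twist K (-k) (-((j : ℕ) : ZMod n)) := by
    rw [← Int.cast_natCast j, ← Int.cast_neg, twist_intCast hn]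
    congr 1
    push_cast
    rw [neg_mul_neg]
  rw [cyclicForm_apply, h, trace_mul_twist hn, neg_neg, ← map_mul (twist K (-(k : ℤ)) (j : ZMod n))]

theorem mem_puncturedTwistedGabidulin_iff (hm : Module.finrank K F = m)
    (hn : Module.finrank K L = n) (hmn : m ∣ n) {k t : ℕ} (ht : 1 ≤ t) (htm : t < m) (μ : L) (s : ℤ)
    (f : F →ₗ[K] L →ₗ[K] K) :
    f ∈ puncturedTwistedGabidulin K F L k t μ s ↔
      ∃ c : ZMod m → L, IsTwistedCoeff K (-k) t (twist K (-k) (t : ZMod n) μ)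
          ((t : ZMod n) - (s : ZMod n)) c ∧
        ∀ x y, f x y = Algebra.trace K L (y * (linPoly (-k) c : F →ₗ[K] L) x) := by
  have hfrob : ∀ a : L, twist K (-k) (t : ZMod n) (μ * frobPow K (s * k) a) =
      twist K (-k) (t : ZMod n) μ * twist K (-k) ((t : ZMod n) - (s : ZMod n)) a := by
    intro a
    rw [map_mul, sub_eq_add_neg, twist_add hn]
    congr 2
    rw [← Int.cast_neg, twist_intCast hn, neg_mul_neg, mul_comm]
  have hsum : ∀ (α : L) (β : ℕ → L) (x : F) (y : L),
      puncture K F L ((cyclicForm K L k 0 α + cyclicForm K L k t (μ * frobPow K (s * k) α)) +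
        ∑ j ∈ Finset.Icc 1 (t - 1), cyclicForm K L k j (β j)) x y =
      Algebra.trace K L (y * (α * algebraMap F L x +
        twist K (-k) (t : ZMod n) μ * twist K (-k) ((t : ZMod n) - (s : ZMod n)) α *
          twist K (-k) (t : ZMod n) (algebraMap F L x) +
        ∑ j ∈ Finset.Icc 1 (t - 1), twist K (-k) (j : ZMod n) (β j) *
          twist K (-k) (j : ZMod n) (algebraMap F L x))) := by
    intro α β x y
    rw [puncture_apply]
    simp only [LinearMap.add_apply, LinearMap.sum_apply, cyclicForm_apply_eq_trace_twist hn, hfrob,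
      mul_add, map_add, Finset.mul_sum, map_sum, Nat.cast_zero, twist_zero]
  rw [puncturedTwistedGabidulin, Submodule.mem_map]
  constructor
  · rintro ⟨f₀, hf₀, rfl⟩
    obtain ⟨g, ⟨α, hα⟩, h, hh, rfl⟩ := Submodule.mem_sup.1 hf₀
    obtain ⟨β', rfl⟩ := (Submodule.mem_iSup_finset_iff_exists_sum _ _).1 hh
    choose β hβ using fun j => LinearMap.mem_range.1 (β' j).2
    have hα' : cyclicForm K L k 0 α + cyclicForm K L k t (μ * frobPow K (s * k) α) = g := hα
    have hβ' : ∀ j, cyclicForm K L k j (β j) = β' j := hβ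
    let c : ZMod m → L := fun i => if i.val = 0 then α else if i.val < t then
      twist K (-k) (i.val : ZMod n) (β i.val) else if i.val = t then
      twist K (-k) (t : ZMod n) μ * twist K (-k) ((t : ZMod n) - (s : ZMod n)) α else 0
    have hc0 : c 0 = α := by simp [c]
    have hct : c t = twist K (-k) (t : ZMod n) μ *
        twist K (-k) ((t : ZMod n) - (s : ZMod n)) α := by
      simp only [c, ZMod.val_cast_of_lt htm]
      rw [if_neg (by omega), if_neg (by omega), if_pos trivial]
    have hcj : ∀ j ∈ Finset.Icc 1 (t - 1), c (j : ZMod m) = twist K (-k) (j : ZMod n) (β j) := by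
      intro j hj
      rw [Finset.mem_Icc] at hj
      simp only [c, ZMod.val_cast_of_lt (show j < m by omega)]
      rw [if_neg (by omega), if_pos (by omega)]
    have hvan : ∀ i, t < i.val → c i = 0 := by
      intro i hi
      simp only [c]
      rw [if_neg (by omega), if_neg (by omega), if_neg (by omega)]
    refine ⟨c, ⟨hvan, by rw [hct, hc0]⟩, fun x y => ?_⟩
    rw [← hα']
    simp only [← hβ']
    rw [hsum, linPoly_apply_of_vanish hm hn hmn ht htm hvan, hc0, hct]
    congr 3
    exact Finset.sum_congr rfl fun j hj => by rw [hcj j hj]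
  · rintro ⟨c, ⟨hvan, hct⟩, hf⟩
    refine ⟨(cyclicForm K L k 0 (c 0) + cyclicForm K L k t (μ * frobPow K (s * k) (c 0))) +
      ∑ j ∈ Finset.Icc 1 (t - 1), cyclicForm K L k j (twist K (-k) (-(j : ZMod n)) (c (j : ZMod m))),
      Submodule.add_mem_sup ⟨c 0, rfl⟩ ?_, ?_⟩
    · exact Submodule.sum_mem _ fun j hj =>
        Submodule.mem_iSup_of_mem j (Submodule.mem_iSup_of_mem hj ⟨_, rfl⟩)
    · ext x y
      rw [hsum, hf, linPoly_apply_of_vanish hm hn hmn ht htm hvan, hct]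
      simp only [twist_apply_twist_neg hn]

end CodeMembership

/-! ### Circulant matrices and linearized polynomials. -/

section Circulant

variable {K L : Type*} [Field K] [Fintype K] [Field L] [Finite L] [Algebra K L]
  {n : ℕ} [NeZero n]

theorem circulant_apply (hn : Module.finrank K L = n) (k : ℕ) (b : ZMod n → L) (i j : Fin n) :
    circulant K L k b i j =
      twist K k (i.val : ZMod n) (b ((j.val : ZMod n) - (i.val : ZMod n))) := by
  rw [circulant, Matrix.of_apply, ← Int.cast_natCast i.val, twist_intCast hn]
  push_cast
  rfl

theorem twist_linPoly (hn : Module.finrank K L = n) (k : ℕ) (b : ZMod n → L) (i : ZMod n) (y : L) :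
    twist K k i ((linPoly (k : ℤ) b : L →ₗ[K] L) y) =
      ∑ z, twist K k i (b (z - i)) * twist K k z y := by
  rw [linPoly_apply, map_sum]
  refine Fintype.sum_equiv (Equiv.addRight i) _ _ fun z => ?_
  rw [map_mul, twistEmb_self, ← twist_add hn, Equiv.coe_addRight, add_sub_cancel_right, add_comm]

/-- A circulant matrix is non-singular if and only if the corresponding linearized polynomial has
no non-trivial zeros. -/
theorem circulant_det_ne_zero_iff (hn : Module.finrank K L = n) {k : ℕ} (hk : IsCoprime (k : ℤ) n)
    (b : ZMod n → L) :
    (circulant K L k b).det ≠ 0 ↔ Function.Injective (linPoly (k : ℤ) b : L →ₗ[K] L) := by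
  constructor
  · intro hdet
    rw [← LinearMap.ker_eq_bot, LinearMap.ker_eq_bot']
    intro y hy
    by_contra hy0
    refine hdet (Matrix.exists_mulVec_eq_zero_iff.1
      ⟨fun j => twist K k (j.val : ZMod n) y, fun h => hy0 ?_, ?_⟩)
    · have := congrFun h 0
      simpa using this
    · funext i
      rw [Matrix.mulVec, dotProduct]
      simp only [circulant_apply hn]
      rw [sum_fin_eq_sum_zmod (fun z => twist K k (i.val : ZMod n) (b (z - (i.val : ZMod n))) *
        twist K k z y), ← twist_linPoly hn, hy, map_zero, Pi.zero_apply]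
  · intro hinj hdet
    obtain ⟨v, hv, hv0⟩ := Matrix.exists_vecMul_eq_zero_iff.2 hdet
    refine hv ?_
    let v' : ZMod n → L := fun z => v ⟨z.val, ZMod.val_lt z⟩
    have hv' : ∀ i : Fin n, v' (i.val : ZMod n) = v i := fun i =>
      congrArg v (Fin.ext (ZMod.val_cast_of_lt i.2))
    have hcol : ∀ z : ZMod n, ∑ i, v' i * twist K k i (b (z - i)) = 0 := by
      intro z
      have := congrFun hv0 ⟨z.val, ZMod.val_lt z⟩
      rw [Matrix.vecMul, dotProduct] at this
      simp only [circulant_apply hn, ← hv', ZMod.natCast_zmod_val, Pi.zero_apply] at this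
      rwa [sum_fin_eq_sum_zmod (fun i => v' i * twist K k i (b (z - i)))] at this
    -- A left null vector gives `∑ v'_i (b(y))^(q^(k i)) = 0` for all `y`. As `y ↦ b(y)` is onto,
    -- this is a linearized polynomial vanishing on `L`.
    have hzero : v' = 0 := by
      refine eq_of_sum_twist_eq hn hk fun x => ?_
      obtain ⟨y, rfl⟩ := (Finite.injective_iff_surjective.1 hinj) x
      simp only [twist_linPoly hn, Finset.mul_sum]
      rw [Finset.sum_comm]
      simp only [← mul_assoc, ← Finset.sum_mul, hcol, zero_mul, Finset.sum_const_zero,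
        Pi.zero_apply]
    funext i
    rw [← hv', hzero]
    rfl

end Circulant

/-! ### The arithmetic condition without the index `j`. -/

section Condition

variable {K F L : Type*} [Field K] [Fintype K] [Field F] [Finite F] [Field L] [Finite L]
  [Algebra K F] [Algebra K L] [Algebra F L] [IsScalarTower K F L]
  {m n : ℕ} [NeZero m] [NeZero n]

theorem frobPow_natCast_mul (hn : Module.finrank K L = n) (k : ℕ) (z : ℤ) :
    (frobPow K (k * z) : L ≃ₐ[K] L) = twist K (-k) (-(z : ZMod n)) := by
  rw [← Int.cast_neg, twist_intCast hn, neg_mul_neg]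

theorem exists_natCast_mul_of_castHom_eq_zero (hmn : m ∣ n) {l : ZMod n}
    (h : ZMod.castHom hmn (ZMod m) l = 0) : ∃ h ∈ Finset.range (n / m), l = ((h * m : ℕ) : ZMod n) := by
  have hd : m ∣ l.val := by
    rw [← ZMod.natCast_eq_zero_iff, ← map_natCast (ZMod.castHom hmn (ZMod m)),
      ZMod.natCast_zmod_val, h]
  refine ⟨l.val / m, Finset.mem_range.2 (Nat.div_lt_div_of_lt_of_dvd hmn (ZMod.val_lt l)), ?_⟩
  rw [Nat.div_mul_cancel hd, ZMod.natCast_zmod_val]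

theorem castHom_natCast_mul (hmn : m ∣ n) (h : ℕ) :
    ZMod.castHom hmn (ZMod m) ((h * m : ℕ) : ZMod n) = 0 := by
  rw [map_natCast, Nat.cast_mul, ZMod.natCast_self, mul_zero]

/-- The arithmetic condition, with the index `h m` replaced by an arbitrary residue modulo `n`. -/
theorem equivCondition_iff (p : ℕ) (hn : Module.finrank K L = n) (hmn : m ∣ n) {k : ℕ}
    (hk : IsCoprime (k : ℤ) n) (t : ℕ) (μ ν : L) (s u : ℤ) :
    EquivCondition K F L p m n k t μ ν s u ↔
      s ≡ u [ZMOD m] ∧ ∃ (e : ℕ) (i : ℤ) (a : F) (b : ZMod n → L), a ≠ 0 ∧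
        (∀ l, b l ≠ 0 → ZMod.castHom hmn (ZMod m) l = 0) ∧
        Function.Injective (linPoly (k : ℤ) b : L →ₗ[K] L) ∧
        ∀ l : ZMod n, algebraMap F L a * twist K (-k) (l - (i : ZMod n)) (μ ^ p ^ e) *
            twist K (-k) (l - (t : ZMod n)) (b l) =
          twist K (-k) (-(u : ZMod n)) (algebraMap F L a) * ν *
            twist K (-k) (l - (s : ZMod n)) (b (l - ((s : ZMod n) - (u : ZMod n)))) := by
  have hrm : ((n / m : ℕ) : ZMod n) * (m : ZMod n) = 0 := by
    rw [← Nat.cast_mul, Nat.div_mul_cancel hmn, ZMod.natCast_self]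
  have hterm : ∀ (j h : ℕ) (i : ℤ) (a : F) (b : ZMod n → L) (e : ℕ), s ≡ u + j * m [ZMOD n] →
      ((algebraMap F L a * frobPow K (k * ((((n / m : ℕ) : ℤ) - h) * m + i)) (μ ^ p ^ e) *
            frobPow K (k * ((((n / m : ℕ) : ℤ) - h) * m + t)) (b ((h * m : ℕ) : ZMod n)) =
          frobPow K (k * u) (algebraMap F L a) * ν *
            frobPow K (k * (((j : ℤ) - h) * m + u)) (b (((h : ZMod n) - (j : ZMod n)) * m))) ↔
        algebraMap F L a * twist K (-k) (((h * m : ℕ) : ZMod n) - (i : ZMod n)) (μ ^ p ^ e) *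
            twist K (-k) (((h * m : ℕ) : ZMod n) - (t : ZMod n)) (b ((h * m : ℕ) : ZMod n)) =
          twist K (-k) (-(u : ZMod n)) (algebraMap F L a) * ν *
            twist K (-k) (((h * m : ℕ) : ZMod n) - (s : ZMod n))
              (b (((h * m : ℕ) : ZMod n) - ((s : ZMod n) - (u : ZMod n))))) := by
    intro j h i a b e hs
    have hs' : (s : ZMod n) = u + j * m := by
      have := (ZMod.intCast_eq_intCast_iff _ _ _).2 hs
      push_cast at this
      exact this
    rw [frobPow_natCast_mul hn, frobPow_natCast_mul hn, frobPow_natCast_mul hn,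
      frobPow_natCast_mul hn]
    have e1 : ∀ z : ℤ, -(((((n / m : ℕ) : ℤ) - h) * m + z : ℤ) : ZMod n) =
        ((h * m : ℕ) : ZMod n) - (z : ZMod n) := by
      intro z
      simp only [Int.cast_add, Int.cast_mul, Int.cast_sub, Int.cast_natCast, Nat.cast_mul]
      linear_combination -hrm
    have e2 : -((((j : ℤ) - h) * m + u : ℤ) : ZMod n) =
        ((h * m : ℕ) : ZMod n) - (s : ZMod n) := by
      rw [hs']
      push_cast
      ring
    have e3 : ((h : ZMod n) - (j : ZMod n)) * m =
        ((h * m : ℕ) : ZMod n) - ((s : ZMod n) - (u : ZMod n)) := by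
      rw [hs']
      push_cast
      ring
    rw [e1, e1, e2, e3, Int.cast_natCast]
  constructor
  · rintro ⟨j, hj, hs, e, i, a, b, ha, hb, hdet, heq⟩
    have hsu : s ≡ u [ZMOD m] := by
      have := hs.of_dvd (Int.natCast_dvd_natCast.2 hmn)
      rw [Int.modEq_iff_dvd] at this ⊢
      have h2 : (m : ℤ) ∣ (j : ℤ) * m := dvd_mul_left _ _
      have := dvd_sub this h2
      rwa [show u + j * m - s - j * m = u - s by ring] at this
    have hsupp : ∀ l, b l ≠ 0 → ZMod.castHom hmn (ZMod m) l = 0 := by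
      intro l hl
      obtain ⟨h, rfl⟩ := hb l hl
      exact castHom_natCast_mul hmn h
    refine ⟨hsu, e, i, a, b, ha, hsupp, (circulant_det_ne_zero_iff hn hk b).1 hdet, fun l => ?_⟩
    by_cases hl : ZMod.castHom hmn (ZMod m) l = 0
    · obtain ⟨h, hh, rfl⟩ := exists_natCast_mul_of_castHom_eq_zero hmn hl
      exact (hterm j h i a b e hs).1 (heq h hh)
    · have h1 : b l = 0 := by
        by_contra h0
        exact hl (hsupp l h0)
      have h2 : b (l - ((s : ZMod n) - (u : ZMod n))) = 0 := by
        by_contra h0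
        have := hsupp _ h0
        rw [map_sub, map_sub, map_intCast, map_intCast, (ZMod.intCast_eq_intCast_iff _ _ _).2 hsu,
          sub_self, sub_zero] at this
        exact hl this
      rw [h1, h2, map_zero, map_zero, mul_zero, mul_zero]
  · rintro ⟨hsu, e, i, a, b, ha, hb, hinj, heq⟩
    -- Here `s - u = m c`, and `j` is `c` reduced modulo `n / m`.
    obtain ⟨c, hc⟩ := hsu.symm.dvd
    have hr : 0 < n / m := Nat.div_pos (Nat.le_of_dvd (NeZero.pos n) hmn) (NeZero.pos m)
    have hr' : ((n / m : ℕ) : ℤ) ≠ 0 := by exact_mod_cast hr.ne'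
    have hnonneg := Int.emod_nonneg c hr'
    have hj : ((c % (n / m : ℕ)).toNat : ℤ) = c % (n / m : ℕ) := Int.toNat_of_nonneg hnonneg
    have hs : s ≡ u + ((c % (n / m : ℕ)).toNat : ℕ) * m [ZMOD n] := by
      rw [hj, Int.modEq_iff_dvd]
      refine ⟨-(c / (n / m : ℕ)), ?_⟩
      have h1 : (n : ℤ) = (n / m : ℕ) * m := by exact_mod_cast (Nat.div_mul_cancel hmn).symm
      have h2 := Int.emod_add_mul_ediv c (n / m : ℕ)
      linear_combination -hc + (c / (n / m : ℕ)) * h1 + m * h2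
    refine ⟨(c % (n / m : ℕ)).toNat, ?_, hs, e, i, a, b, ha, ?_, ?_, ?_⟩
    · rw [Finset.mem_range]
      have := Int.emod_lt_of_pos c (show (0 : ℤ) < (n / m : ℕ) by exact_mod_cast hr)
      omega
    · intro l hl
      obtain ⟨h, -, rfl⟩ := exists_natCast_mul_of_castHom_eq_zero hmn (hb l hl)
      exact ⟨h, rfl⟩
    · exact (circulant_det_ne_zero_iff hn hk b).2 hinj
    · exact fun h _ => (hterm _ h i a b e hs).2 (heq _)

end Condition

/-! ### Transformations that map one code into the other. -/

section Transformation

variable {K F L : Type*} [Field K] [Fintype K] [Field F] [Finite F] [Field L] [Finite L]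
  [Algebra K F] [Algebra K L] [Algebra F L] [IsScalarTower K F L]
  {m n : ℕ} [NeZero m] [NeZero n] {κ : ℤ}

/-- The trace adjoint of a linearized polynomial, term by term. -/
theorem trace_linPoly_mul (hn : Module.finrank K L = n) (g : ZMod n → L) (y z : L) :
    Algebra.trace K L ((linPoly κ g : L →ₗ[K] L) y * z) =
      Algebra.trace K L (y * ∑ l, twist K κ l (g (-l)) * twist K κ l z) := by
  rw [linPoly_apply, ← Equiv.sum_comp (Equiv.neg (ZMod n)), Finset.sum_mul, map_sum, Finset.mul_sum,
    map_sum]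
  refine Finset.sum_congr rfl fun l _ => ?_
  rw [Equiv.neg_apply, twistEmb_self, mul_right_comm, trace_mul_twist hn, neg_neg,
    map_mul (twist K κ l)]

theorem sum_twist_mul_twist_linPoly (hm : Module.finrank K F = m) (hn : Module.finrank K L = n)
    (hmn : m ∣ n) {a : ZMod m → L} {A : F →ₗ[K] F}
    (hA : ∀ x, algebraMap F L (A x) = (linPoly κ a : F →ₗ[K] L) x) (b : ZMod n → L) (γ : L)
    (z : ZMod n) (x : F) :
    ∑ l, b l * twist K κ l (γ * twist K κ z (algebraMap F L (A x))) =
      ∑ d : ZMod m, (∑ l, b l * twist K κ l γ * twist K κ (l + z)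
        (a (d - ZMod.castHom hmn (ZMod m) l - ZMod.castHom hmn (ZMod m) z))) *
          twistEmb K F L κ d x := by
  simp only [Finset.sum_mul]
  rw [Finset.sum_comm]
  refine Finset.sum_congr rfl fun l _ => ?_
  rw [map_mul, ← twist_add hn, hA, linPoly_apply, map_sum, Finset.mul_sum, Finset.mul_sum]
  refine Fintype.sum_equiv (Equiv.addRight (ZMod.castHom hmn (ZMod m) (l + z))) _ _ fun i => ?_
  rw [map_mul, twist_twistEmb hm hn hmn, Equiv.coe_addRight, map_add]
  dsimp only
  rw [show i + (ZMod.castHom hmn (ZMod m) l + ZMod.castHom hmn (ZMod m) z) -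
      ZMod.castHom hmn (ZMod m) l - ZMod.castHom hmn (ZMod m) z = i by ring, add_comm i]
  ring

theorem sum_twist_mul_mixed (hm : Module.finrank K F = m) (hn : Module.finrank K L = n)
    (hmn : m ∣ n) {a : ZMod m → L} {A : F →ₗ[K] F}
    (hA : ∀ x, algebraMap F L (A x) = (linPoly κ a : F →ₗ[K] L) x) (b : ZMod n → L) (t : ℕ) (η : L)
    (w : ZMod n) (α : L) (x : F) :
    ∑ l, b l * twist K κ l (α * algebraMap F L (A x) +
        η * twist K κ w α * twist K κ (t : ZMod n) (algebraMap F L (A x))) =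
      ∑ d : ZMod m, (∑ l, mixedCoeff K κ (ZMod.castHom hmn (ZMod m)) a b t η w d l *
        twist K κ l α) * twistEmb K F L κ d x := by
  have h1 := sum_twist_mul_twist_linPoly hm hn hmn hA b α 0 x
  have h2 := sum_twist_mul_twist_linPoly hm hn hmn hA b (η * twist K κ w α) (t : ZMod n) x
  rw [twist_zero] at h1
  simp only [map_add (twist K κ _), mul_add, Finset.sum_add_distrib]
  rw [h1, h2, ← Finset.sum_add_distrib]
  refine Finset.sum_congr rfl fun d _ => ?_
  rw [← add_mul]
  congr 1
  simp only [mixedCoeff, add_mul, Finset.sum_add_distrib, map_zero, sub_zero, add_zero,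
    map_natCast]
  congr 1
  · exact Finset.sum_congr rfl fun l _ => by ring
  · refine Fintype.sum_equiv (Equiv.addRight w) _ _ fun l => ?_
    rw [Equiv.coe_addRight, add_sub_cancel_right, map_mul, ← twist_add hn]
    ring

/-- If `B ∘ X ∘ A` belongs to the second code for every `X` in the first one, then `A` is monomial
and `B` is supported on one residue class modulo `m`. -/
theorem monomial_of_maps_isTwistedCoeff (hm : Module.finrank K F = m) (hn : Module.finrank K L = n)
    (hmn : m ∣ n) (hκ : IsCoprime κ n) {t : ℕ} (ht : 1 ≤ t) (htm : t + 2 ≤ m) {η η' : L}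
    (hη : η ≠ 0) {w w' : ZMod n} {σ : ZMod m} (hσ : σ = t - ZMod.castHom hmn (ZMod m) w)
    (h0 : σ ≠ 0) (h1 : σ ≠ 1) (h1' : σ ≠ -1) (h2 : σ ≠ 2) (h2' : σ ≠ -2)
    {a : ZMod m → L} {A : F →ₗ[K] F}
    (hA : ∀ x, algebraMap F L (A x) = (linPoly κ a : F →ₗ[K] L) x) (hAs : Function.Surjective A)
    {b : ZMod n → L} {l₀ : ZMod n} (hl₀ : b l₀ ≠ 0)
    (H : ∀ c : ZMod m → L, IsTwistedCoeff K κ t η w c →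
      ∃ c' : ZMod m → L, IsTwistedCoeff K κ t η' w' c' ∧
        ∀ x, ∑ l, b l * twist K κ l ((linPoly κ c : F →ₗ[K] L) (A x)) =
          (linPoly κ c' : F →ₗ[K] L) x) :
    ZMod.castHom hmn (ZMod m) w = ZMod.castHom hmn (ZMod m) w' ∧
      ∃ i₀ : ZMod m, a i₀ ≠ 0 ∧ (∀ i, i ≠ i₀ → a i = 0) ∧
        (∀ l, b l ≠ 0 → ZMod.castHom hmn (ZMod m) l = -i₀) ∧
        ∀ l, b (l - w) * twist K κ (l - w) η * twist K κ (l - w + (t : ZMod n)) (a i₀) =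
          η' * twist K κ w' (b (l - w')) * twist K κ l (a i₀) := by
  have hκm : IsCoprime κ m := hκ.of_isCoprime_of_dvd_right (Int.natCast_dvd_natCast.2 hmn)
  have htv : ((t : ℕ) : ZMod m).val = t := ZMod.val_cast_of_lt (by omega)
  have ht0 : ((t : ℕ) : ZMod m) ≠ 0 := by
    intro h
    rw [h, ZMod.val_zero] at htv
    omega
  have hM : ∀ α : L, ∃ c' : ZMod m → L, IsTwistedCoeff K κ t η' w' c' ∧ ∀ d,
      ∑ l, mixedCoeff K κ (ZMod.castHom hmn (ZMod m)) a b t η w d l * twist K κ l α = c' d := by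
    intro α
    -- Testing on the twisted part alone, for all `α`, permits comparison of coefficients in `α`.
    let c : ZMod m → L := fun i => if i = 0 then α else if i = t then η * twist K κ w α else 0
    have hc0 : c 0 = α := by simp [c]
    have hct : c t = η * twist K κ w α := by simp [c, ht0]
    have hcj : ∀ i : ZMod m, i ≠ 0 → i ≠ t → c i = 0 := by
      intro i hi0 hit
      simp [c, hi0, hit]
    have hvan : ∀ i : ZMod m, t < i.val → c i = 0 := by
      intro i hi
      refine hcj i ?_ ?_
      · rintro rfl
        rw [ZMod.val_zero] at hi
        omega
      · rintro rfl
        omega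
    obtain ⟨c', hc', heq⟩ := H c ⟨hvan, by rw [hct, hc0]⟩
    refine ⟨c', hc', congrFun (eq_of_sum_twistEmb_eq (F := F) hm hκm fun x => ?_)⟩
    rw [← linPoly_apply c', ← heq, ← sum_twist_mul_mixed hm hn hmn hA]
    refine Finset.sum_congr rfl fun l _ => ?_
    rw [linPoly_apply_of_vanish hm hn hmn ht (by omega) hvan, hc0, hct, Finset.sum_eq_zero,
      add_zero]
    intro j hj
    rw [Finset.mem_Icc] at hj
    have hjv : ((j : ℕ) : ZMod m).val = j := ZMod.val_cast_of_lt (by omega)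
    rw [hcj, zero_mul]
    · intro h
      rw [h, ZMod.val_zero] at hjv
      omega
    · intro h
      rw [h, htv] at hjv
      omega
  have hE1 : ∀ d : ZMod m, t < d.val → ∀ l,
      mixedCoeff K κ (ZMod.castHom hmn (ZMod m)) a b t η w d l = 0 := by
    intro d hd
    refine congrFun (eq_of_sum_twist_eq (d := 0) hn hκ fun α => ?_)
    obtain ⟨c', hc', heq⟩ := hM α
    rw [heq, hc'.1 d hd]
    simp
  have hE3 : ∀ l, mixedCoeff K κ (ZMod.castHom hmn (ZMod m)) a b t η w t l =
      η' * twist K κ w' (mixedCoeff K κ (ZMod.castHom hmn (ZMod m)) a b t η w 0 (l - w')) := by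
    refine congrFun (eq_of_sum_twist_eq hn hκ fun α => ?_)
    obtain ⟨c', hc', heq⟩ := hM α
    rw [heq, hc'.2, ← heq, map_sum, Finset.mul_sum]
    refine Fintype.sum_equiv (Equiv.addRight w') _ _ fun l => ?_
    rw [Equiv.coe_addRight, add_sub_cancel_right, map_mul, ← twist_add hn, add_comm w' l, mul_assoc]
  have hE0 : ∀ j : ℕ, 1 ≤ j → j < t → ∀ d : ZMod m, t < d.val → ∀ l, b l ≠ 0 →
      a (d - ZMod.castHom hmn (ZMod m) l - j) = 0 := by
    intro j hj hjt d hd l hl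
    have hjv : ((j : ℕ) : ZMod m).val = j := ZMod.val_cast_of_lt (by omega)
    have hz : ∀ γ : L, ∑ l, b l * twist K κ (l + (j : ZMod n))
        (a (d - ZMod.castHom hmn (ZMod m) l - j)) * twist K κ l γ = 0 := by
      intro γ
      -- Testing on the single component `j`.
      let c : ZMod m → L := fun i => if i = j then γ else 0
      have hcj : c j = γ := by simp [c]
      have hci : ∀ i : ZMod m, i ≠ j → c i = 0 := by
        intro i hi
        simp [c, hi]
      have hj0 : (0 : ZMod m) ≠ j := by
        intro h
        rw [← h, ZMod.val_zero] at hjv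
        omega
      have hjt' : (t : ZMod m) ≠ j := by
        intro h
        rw [← h, htv] at hjv
        omega
      obtain ⟨c', hc', heq⟩ := H c ⟨fun i hi => hci i (by rintro rfl; omega),
        by rw [hci _ hj0, hci _ hjt', map_zero, mul_zero]⟩
      have := congrFun (eq_of_sum_twistEmb_eq (F := F) hm hκm (c := fun d => ∑ l, b l *
        twist K κ l γ * twist K κ (l + (j : ZMod n)) (a (d - ZMod.castHom hmn (ZMod m) l -
          ZMod.castHom hmn (ZMod m) (j : ZMod n)))) (d := c') fun x => by
            rw [← linPoly_apply c', ← heq, ← sum_twist_mul_twist_linPoly hm hn hmn hA]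
            refine Finset.sum_congr rfl fun l _ => ?_
            rw [linPoly_apply, Finset.sum_eq_single_of_mem (j : ZMod m) (Finset.mem_univ _)
              (fun i _ hi => by rw [hci i hi, zero_mul]), hcj, twistEmb_natCast hm hn hmn]) d
      rw [hc'.1 d hd] at this
      simp only [map_natCast] at this
      rw [← this]
      exact Finset.sum_congr rfl fun l _ => mul_right_comm _ _ _
    have := congrFun (eq_of_sum_twist_eq hn hκ (d := 0) fun γ => by
      rw [hz]; simp) l
    simpa [hl] using this
  -- Otherwise `y = c y^(q^(κ(t - w)))` on the image of `A`, which is all of `F`. Then `y = 1` gives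
  -- `c = 1`, so the twist by `σ` is trivial on `F`, although `σ ≠ 0`.
  have hAne : ∀ c : L, ∃ i, a i ≠ c * twist K κ ((t : ZMod n) - w) (a (i - σ)) := by
    intro c
    by_contra! hc
    have hy : ∀ y : F, algebraMap F L y =
        c * twist K κ ((t : ZMod n) - w) (algebraMap F L y) := by
      intro y
      obtain ⟨x, rfl⟩ := hAs y
      rw [hA, linPoly_apply, map_sum, Finset.mul_sum]
      refine Fintype.sum_equiv (Equiv.subRight σ) _ _ fun i => ?_
      rw [hc, map_mul, twist_twistEmb hm hn hmn, map_sub, map_natCast, ← hσ, Equiv.subRight_apply,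
        add_sub_cancel, mul_assoc]
    have hc1 : c = 1 := by simpa using (hy 1).symm
    refine h0 (twist_injective hm hκm (AlgEquiv.ext fun y => (algebraMap F L).injective ?_))
    have := hy y
    rw [hc1, one_mul, twist_algebraMap hm hn hmn, map_sub, map_natCast, ← hσ] at this
    rw [← this, twist_zero]
  have hsupp : ∀ i l, a i ≠ 0 → b l ≠ 0 → i + ZMod.castHom hmn (ZMod m) l = 0 := by
    intro i l hi hl
    subst hσ
    obtain rfl | ht2 : t = 1 ∨ 2 ≤ t := by omega
    -- For `m = 3` the residues `0, 1, -1` exhaust all values of `σ`.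
    · have hm4 : 4 ≤ m := by
        by_contra hlt
        have h3 : m = 3 := by omega
        subst h3
        generalize ((1 : ℕ) : ZMod 3) - ZMod.castHom hmn (ZMod 3) w = σ at h0 h1 h2
        revert σ
        decide
      rw [Nat.cast_one] at h0 h1 h1' h2 h2' hAne
      rw [Nat.cast_one] at hAne
      exact add_eq_zero_of_one hn hη hm4 h0 h1 h1' h2 h2' hE1 hAne hi hl
    · exact add_eq_zero_of_two_le hη ht2 htm h0 h1' h2' hE0 hE1 hi hl
  obtain ⟨i₀, hi₀⟩ : ∃ i, a i ≠ 0 := by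
    obtain ⟨i, hi⟩ := hAne 0
    exact ⟨i, by simpa using hi⟩
  obtain ⟨hw, hrel⟩ := coeff_relation_of_support hn hη ht0 hsupp hE3 hi₀ hl₀
  refine ⟨hw, i₀, hi₀, fun i hi => ?_, fun l hl => ?_, hrel⟩
  · by_contra h
    exact hi (add_right_cancel ((hsupp i l₀ h hl₀).trans (hsupp i₀ l₀ hi₀ hl₀).symm))
  · exact eq_neg_of_add_eq_zero_right (hsupp i₀ l hi₀ hl)

end Transformation

/-! ### Field automorphisms of `K` as powers of the `p`-Frobenius. -/

section Frobenius

variable (p : ℕ) [Fact p.Prime] {K F L : Type*} [Field K] [Fintype K] [CharP K p]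
  [Field F] [Finite F] [Field L] [Finite L]
  [Algebra K F] [Algebra K L] [Algebra F L] [IsScalarTower K F L]

theorem exists_ringEquiv_eq_pow (θ : K ≃+* K) : ∃ e : ℕ, ∀ c, θ c = c ^ p ^ e := by
  let _ : Algebra (ZMod p) K := ZMod.algebra K p
  let θ' : K ≃ₐ[ZMod p] K := AlgEquiv.ofRingEquiv (f := θ) fun r =>
    RingHom.congr_fun (Subsingleton.elim ((θ : K →+* K).comp (algebraMap (ZMod p) K)) _) r
  obtain ⟨e, he⟩ := (FiniteField.bijective_frobeniusAlgEquivOfAlgebraic_pow (ZMod p) K).2 θ'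
  refine ⟨e, fun c => ?_⟩
  have h := DFunLike.congr_fun he c
  have h2 := congrFun (FiniteField.coe_frobeniusAlgEquivOfAlgebraic_iterate (ZMod p) K e.1) c
  simp only [AlgEquiv.coe_pow] at h
  rw [h2, ZMod.card] at h
  exact h.symm

theorem charP_of_algebra (K L : Type*) [Field K] [CharP K p] [Field L] [Algebra K L] : CharP L p :=
  charP_of_injective_algebraMap (algebraMap K L).injective p

theorem trace_pow_char_pow (e : ℕ) (z : L) :
    Algebra.trace K L (z ^ p ^ e) = Algebra.trace K L z ^ p ^ e := by
  have := charP_of_algebra p K L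
  have h := Algebra.trace_eq_of_equiv_equiv (iterateFrobeniusEquiv K p e)
    (iterateFrobeniusEquiv L p e) (by ext x; simp [iterateFrobenius_def]) z
  rw [RingEquiv.eq_symm_apply] at h
  simpa only [iterateFrobeniusEquiv_def] using h.symm

theorem linPoly_pow_char_pow {m : ℕ} [NeZero m] {κ : ℤ} (e : ℕ) (c : ZMod m → L) (x : F) :
    (linPoly κ c : F →ₗ[K] L) x ^ p ^ e =
      (linPoly κ (fun i => c i ^ p ^ e) : F →ₗ[K] L) (x ^ p ^ e) := by
  have := charP_of_algebra p K L
  rw [linPoly_apply, linPoly_apply, sum_pow_char_pow]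
  simp only [mul_pow, map_pow]

/-- A semilinear map followed by a power of the Frobenius automorphism is linear. -/
theorem exists_linearMap_eq_pow {θ : K ≃+* K} {e : ℕ} (hθ : ∀ c, θ c = c ^ p ^ e) {g : L ≃+ L}
    (hg : ∀ (c : K) v, g (c • v) = θ.symm c • g v) :
    ∃ A : L →ₗ[K] L, Function.Bijective A ∧ ∀ x, A x = g x ^ p ^ e := by
  have := charP_of_algebra p K L
  let A : L →ₗ[K] L :=
    { toFun := fun x => g x ^ p ^ e
      map_add' := fun x y => by rw [map_add, add_pow_char_pow]
      map_smul' := fun c x => by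
        rw [hg, smul_pow, ← hθ, θ.apply_symm_apply, RingHom.id_apply] }
  have hA : Function.Injective A := by
    intro x y h
    refine g.injective ((iterateFrobeniusEquiv L p e).injective ?_)
    rw [iterateFrobeniusEquiv_def, iterateFrobeniusEquiv_def]
    exact h
  exact ⟨A, ⟨hA, Finite.injective_iff_surjective.1 hA⟩, fun x => rfl⟩

/-- A linear bijection preceded by the inverse of a power of the Frobenius automorphism. -/
theorem exists_addEquiv_pow_eq (e : ℕ) {A : L →ₗ[K] L} (hA : Function.Injective A) :
    ∃ g : L ≃+ L, (∀ (c : K) v, g (c • v) = (iterateFrobeniusEquiv K p e).symm c • g v) ∧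
      ∀ x, A x = g x ^ p ^ e := by
  have := charP_of_algebra p K L
  let g : L ≃+ L := (AddEquiv.ofBijective A ⟨hA, Finite.injective_iff_surjective.1 hA⟩).trans
    (iterateFrobeniusEquiv L p e).symm.toAddEquiv
  have hg : ∀ x, A x = g x ^ p ^ e := by
    intro x
    rw [← iterateFrobeniusEquiv_def]
    exact ((iterateFrobeniusEquiv L p e).apply_symm_apply (A x)).symm
  refine ⟨g, fun c v => (iterateFrobeniusEquiv L p e).injective ?_, hg⟩
  rw [iterateFrobeniusEquiv_def, iterateFrobeniusEquiv_def, ← hg, smul_pow, ← hg,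
    ← iterateFrobeniusEquiv_def (R := K), RingEquiv.apply_symm_apply, map_smul]

end Frobenius

/-! ### Product equivalence and the arithmetic condition. -/

section Equivalence

variable {K F L : Type*} [Field K] [Fintype K]
  [Field F] [Finite F] [Field L] [Finite L]
  [Algebra K F] [Algebra K L] [Algebra F L] [IsScalarTower K F L]
  {m n : ℕ} [NeZero m] [NeZero n]

theorem traceForm_comp_apply (X : F →ₗ[K] L) (x : F) (y : L) :
    ((Algebra.traceForm K L : L →ₗ[K] L →ₗ[K] K) ∘ₗ X) x y = Algebra.trace K L (y * X x) := by
  rw [LinearMap.comp_apply, Algebra.traceForm_apply, mul_comm]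

theorem puncturedTwistedGabidulin_eq_image (hm : Module.finrank K F = m)
    (hn : Module.finrank K L = n) (hmn : m ∣ n) {k t : ℕ} (ht : 1 ≤ t) (htm : t < m) (μ : L)
    (s : ℤ) :
    (puncturedTwistedGabidulin K F L k t μ s : Set (F →ₗ[K] L →ₗ[K] K)) =
      (fun c : ZMod m → L => (Algebra.traceForm K L : L →ₗ[K] L →ₗ[K] K) ∘ₗ
        (linPoly (-k) c : F →ₗ[K] L)) ''
        {c | IsTwistedCoeff K (-k) t (twist K (-k) (t : ZMod n) μ)
          ((t : ZMod n) - (s : ZMod n)) c} := by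
  ext f
  rw [SetLike.mem_coe, mem_puncturedTwistedGabidulin_iff hm hn hmn ht htm]
  constructor
  · rintro ⟨c, hc, hf⟩
    exact ⟨c, hc, LinearMap.ext₂ fun x y => by rw [traceForm_comp_apply, hf]⟩
  · rintro ⟨c, hc, rfl⟩
    exact ⟨c, hc, fun x y => traceForm_comp_apply _ x y⟩

theorem traceForm_comp_linPoly_injective (hm : Module.finrank K F = m) {κ : ℤ}
    (hκ : IsCoprime κ m) : Function.Injective
      fun c : ZMod m → L => (Algebra.traceForm K L : L →ₗ[K] L →ₗ[K] K) ∘ₗ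
        (linPoly κ c : F →ₗ[K] L) := by
  intro c d h
  refine linPoly_injective hm hκ (LinearMap.ext fun x => eq_of_forall_trace_mul (K := K) fun y => ?_)
  rw [← traceForm_comp_apply, ← traceForm_comp_apply]
  exact LinearMap.congr_fun₂ h x y

theorem twistEmb_twist (hm : Module.finrank K F = m) {κ : ℤ} (i j : ZMod m) (x : F) :
    twistEmb K F L κ i (twist K κ j x) = twistEmb K F L κ (i + j) x := by
  rw [twistEmb_apply, ← twist_add hm, twistEmb_apply]

/-- The coefficient at `t` is determined by the one at `0`, so rewriting it passes injectively
between any two such codes. -/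
theorem ncard_isTwistedCoeff_le {κ : ℤ} {t : ℕ} (ht : 1 ≤ t) (htm : t < m) (η η' : L)
    (w w' : ZMod n) : {c : ZMod m → L | IsTwistedCoeff K κ t η w c}.ncard ≤
      {c : ZMod m → L | IsTwistedCoeff K κ t η' w' c}.ncard := by
  have htv : ((t : ℕ) : ZMod m).val = t := ZMod.val_cast_of_lt htm
  have ht0 : (0 : ZMod m) ≠ t := by
    intro h
    rw [← h, ZMod.val_zero] at htv
    omega
  refine Set.ncard_le_ncard_of_injOn
    (fun c => Function.update c (t : ZMod m) (η' * twist K κ w' (c 0))) ?_ ?_ (Set.toFinite _)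
  · intro c hc
    refine ⟨fun i hi => ?_, ?_⟩
    · rw [Function.update_of_ne (by rintro rfl; omega), hc.1 i hi]
    · rw [Function.update_self, Function.update_of_ne ht0]
  · intro c hc d hd h
    have hne : ∀ i, i ≠ (t : ZMod m) → c i = d i := fun i hi => by
      simpa [hi] using congrFun h i
    funext i
    by_cases hi : i = t
    · rw [hi, hc.2, hd.2, hne 0 ht0]
    · exact hne i hi

theorem exists_productAut {V V' : Type*} [AddCommGroup V] [Module K V] [FiniteDimensional K V]
    [AddCommGroup V'] [Module K V'] [FiniteDimensional K V'] (θ : K ≃+* K) (g : V ≃+ V)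
    (g' : V' ≃+ V') (hg : ∀ (c : K) v, g (c • v) = θ.symm c • g v)
    (hg' : ∀ (c : K) v, g' (c • v) = θ.symm c • g' v) :
    ∃ τ : (V →ₗ[K] V' →ₗ[K] K) ≃+ (V →ₗ[K] V' →ₗ[K] K), IsProductAut τ ∧
      ∀ f v v', τ f v v' = θ (f (g v) (g' v')) := by
  have hfin : Finite (V →ₗ[K] V' →ₗ[K] K) := Module.finite_of_finite K
  let τ₀ : (V →ₗ[K] V' →ₗ[K] K) →+ (V →ₗ[K] V' →ₗ[K] K) :=
    { toFun := fun f => LinearMap.mk₂ K (fun v v' => θ (f (g v) (g' v')))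
        (fun v w v' => by simp) (fun c v v' => by simp [hg])
        (fun v v' w' => by simp) (fun c v v' => by simp [hg'])
      map_zero' := by ext; simp
      map_add' := fun f f' => by ext; simp }
  have hτ₀ : ∀ f v v', τ₀ f v v' = θ (f (g v) (g' v')) := fun f v v' => rfl
  have hinj : Function.Injective τ₀ := by
    intro f f' h
    ext v v'
    have := LinearMap.congr_fun₂ h (g.symm v) (g'.symm v')
    simpa [hτ₀] using this
  let τ := AddEquiv.ofBijective τ₀ ⟨hinj, Finite.injective_iff_surjective.1 hinj⟩
  exact ⟨τ, ⟨θ, g, g', hg, hg', hτ₀⟩, hτ₀⟩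

/-- The transformation given by the arithmetic condition maps twisted coefficients to twisted
coefficients. -/
theorem exists_isTwistedCoeff_of_condition (hm : Module.finrank K F = m)
    (hn : Module.finrank K L = n) (hmn : m ∣ n) {k t : ℕ} {μ ν : L} {s u i : ℤ}
    {a : F} {b : ZMod n → L}
    (hb : ∀ l, b l ≠ 0 → ZMod.castHom hmn (ZMod m) l = 0)
    (heq : ∀ l : ZMod n, algebraMap F L a * twist K (-k) (l - (i : ZMod n)) μ *
        twist K (-k) (l - (t : ZMod n)) (b l) =
      twist K (-k) (-(u : ZMod n)) (algebraMap F L a) * ν *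
        twist K (-k) (l - (s : ZMod n)) (b (l - ((s : ZMod n) - (u : ZMod n)))))
    {c : ZMod m → L} (hc : IsTwistedCoeff K (-k) t (twist K (-k) (t : ZMod n) μ)
      ((t : ZMod n) - (s : ZMod n)) c) :
    ∃ c' : ZMod m → L, IsTwistedCoeff K (-k) t (twist K (-k) (t : ZMod n) ν)
        ((t : ZMod n) - (u : ZMod n)) c' ∧
      ∀ (x : F) (y : L), Algebra.trace K L
          (twist K (-k) (i : ZMod n) ((linPoly (k : ℤ) b : L →ₗ[K] L) y) *
            (linPoly (-k) c : F →ₗ[K] L) (twist K (-k) (i : ZMod m) (a * x))) =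
        Algebra.trace K L (y * (linPoly (-k) c' : F →ₗ[K] L) x) := by
  refine ⟨fun j => ∑ l, twist K (-k) l (b l * (twist K (-k) (-(i : ZMod n)) (c j))) *
    twistEmb K F L (-k) j a, ⟨fun j hj => ?_, ?_⟩, fun x y => ?_⟩
  · simp [hc.1 j hj]
  · dsimp only
    rw [hc.2, map_sum, Finset.mul_sum]
    refine Fintype.sum_equiv (Equiv.subRight ((s : ZMod n) - (u : ZMod n))) _ _ fun l => ?_
    rw [Equiv.subRight_apply, twistEmb_natCast hm hn hmn]
    have h := congrArg (twist K (-k) (t : ZMod n)) (heq l)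
    simp only [map_mul, ← twist_add hn] at h ⊢
    rw [twistEmb_apply, twist_zero,
      show (t : ZMod n) - u + (l - (s - u)) = t + (l - s) by ring,
      show l + (-(i : ZMod n) + t) = t + (l - i) by ring,
      show l + (-(i : ZMod n) + (t - s)) = t - u + (l - (s - u) + -i) by ring]
    rw [add_sub_cancel] at h
    have e1 : (t : ZMod n) + -(u : ZMod n) = t - u := by ring
    rw [e1] at h
    linear_combination (twist K (-k)
      ((t : ZMod n) - (u : ZMod n) + (l - ((s : ZMod n) - (u : ZMod n)) + -(i : ZMod n))) (c 0)) * h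
  · rw [mul_comm, trace_mul_twist hn, trace_linPoly_mul hn]
    congr 2
    rw [← Equiv.sum_comp (Equiv.neg (ZMod n)), linPoly_apply, linPoly_apply]
    simp only [Equiv.neg_apply, neg_neg, map_sum, Finset.mul_sum, Finset.sum_mul]
    rw [Finset.sum_comm]
    refine Finset.sum_congr rfl fun j _ => Finset.sum_congr rfl fun l _ => ?_
    by_cases hbl : b l = 0
    · simp [hbl]
    -- On the support of `b` the index `l` is divisible by `m`, so the twist by `l` fixes `F`, and
    -- the shifts by `i` cancel.
    · have hE : ∀ z : F, twist K (-k) l (twist K (-k) (-(i : ZMod n))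
          (twistEmb K F L (-k) j (twist K (-k) (i : ZMod m) z))) = twistEmb K F L (-k) j z := by
        intro z
        rw [twist_twistEmb hm hn hmn, twist_twistEmb hm hn hmn, hb l hbl, zero_add, map_neg,
          map_intCast, twistEmb_twist hm, neg_add_cancel_comm]
      rw [← twist_neg_left hn l, map_mul, map_mul, hE]
      rw [map_mul (twistEmb K F L (-(k : ℤ)) j), map_mul (twist K (-(k : ℤ)) l)]
      ring

theorem linPoly_adjoint_shift (hn : Module.finrank K L = n) (k : ℕ) (g : ZMod n → L) (i : ZMod n)
    (y : L) :
    (linPoly (k : ℤ) (fun l => twist K (-k) (-l) (twist K (-k) (l - i) (g (-(l - i))))) :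
      L →ₗ[K] L) y = twist K (-k) (-i) ((linPoly (-k) g : L →ₗ[K] L) y) := by
  rw [linPoly_apply, linPoly_apply, map_sum]
  refine Fintype.sum_equiv (Equiv.subLeft i) _ _ fun l => ?_
  have hk : twist K (k : ℤ) l y = twist K (-k) (-l) y := by rw [twist_neg_left hn, neg_neg]
  rw [Equiv.subLeft_apply, map_mul, twistEmb_self, twistEmb_self, ← twist_add hn, ← twist_add hn,
    hk, neg_sub, show -l + (l - i) = -i by ring, show -i + (i - l) = -l by ring]

theorem ProductEquiv.equivCondition (p : ℕ) [Fact p.Prime] [CharP K p]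
    (hm : Module.finrank K F = m)
    (hn : Module.finrank K L = n) (hmn : m ∣ n) {k t : ℕ} (hk : IsCoprime (k : ℤ) n) (ht : 1 ≤ t)
    (htm : t + 2 ≤ m) {s u : ℤ} (hs0 : ¬ s ≡ 0 [ZMOD m]) (hs1 : ¬ s ≡ 1 [ZMOD m])
    (hs1' : ¬ s ≡ -1 [ZMOD m]) (hs2 : ¬ s ≡ 2 [ZMOD m]) (hs2' : ¬ s ≡ -2 [ZMOD m]) {μ ν : L}
    (hμ : μ ≠ 0)
    (h : ProductEquiv
      (puncturedTwistedGabidulin K F L k t μ s : Set (F →ₗ[K] L →ₗ[K] K))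
      (puncturedTwistedGabidulin K F L k t ν u : Set (F →ₗ[K] L →ₗ[K] K))) :
    EquivCondition K F L p m n k t μ ν s u := by
  have := charP_of_algebra p K L
  obtain ⟨τ, ⟨θ, g, g', hg, hg', hτ⟩, himg⟩ := h
  obtain ⟨e, hθ⟩ := exists_ringEquiv_eq_pow p θ
  obtain ⟨A, hA, hAg⟩ := exists_linearMap_eq_pow p hθ hg
  obtain ⟨G, hG, hGg⟩ := exists_linearMap_eq_pow p hθ hg'
  have hκ : IsCoprime (-k : ℤ) n := hk.neg_left
  have hκm : IsCoprime (-k : ℤ) m :=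
    hκ.of_isCoprime_of_dvd_right (Int.natCast_dvd_natCast.2 hmn)
  obtain ⟨a, ha⟩ := linPoly_surjective hm hκm
    ((IsScalarTower.toAlgHom K F L).toLinearMap ∘ₗ A)
  have hAa : ∀ x, algebraMap F L (A x) = (linPoly (-k) a : F →ₗ[K] L) x := fun x => by
    rw [ha]; rfl
  obtain ⟨γ, rfl⟩ := linPoly_surjective (F := L) hn hκ G
  let b : ZMod n → L := fun l => twist K (-k) l (γ (-l))
  obtain ⟨l₀, hl₀⟩ : ∃ l, b l ≠ 0 := by
    by_contra! hb
    have h0 : (linPoly (-k) γ : L →ₗ[K] L) 1 = 0 := by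
      rw [linPoly_apply]
      refine Finset.sum_eq_zero fun l _ => ?_
      have := hb (-l)
      simp only [b, neg_neg, EmbeddingLike.map_eq_zero_iff] at this
      rw [this, zero_mul]
    exact one_ne_zero (hG.1 (h0.trans (map_zero _).symm))
  have H : ∀ c : ZMod m → L, IsTwistedCoeff K (-k) t (twist K (-k) (t : ZMod n) (μ ^ p ^ e))
      ((t : ZMod n) - (s : ZMod n)) c →
      ∃ c' : ZMod m → L, IsTwistedCoeff K (-k) t (twist K (-k) (t : ZMod n) ν)
        ((t : ZMod n) - (u : ZMod n)) c' ∧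
        ∀ x, ∑ l, b l * twist K (-k) l ((linPoly (-k) c : F →ₗ[K] L) (A x)) =
          (linPoly (-k) c' : F →ₗ[K] L) x := by
    intro c hc
    -- Taking `p^e`-th roots of the coefficients gives a word of the original code with parameter
    -- `μ`, whose image under `τ` is then computed.
    let π := iterateFrobeniusEquiv L p e
    have hπ : ∀ x, π x = x ^ p ^ e := iterateFrobeniusEquiv_def L p e
    have hroot : ∀ i, π.symm (c i) ^ p ^ e = c i := fun i => by
      rw [← hπ, RingEquiv.apply_symm_apply]
    have hmem : ((Algebra.traceForm K L : L →ₗ[K] L →ₗ[K] K) ∘ₗ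
        (linPoly (-k) (fun i => π.symm (c i)) : F →ₗ[K] L)) ∈
          (puncturedTwistedGabidulin K F L k t μ s : Set (F →ₗ[K] L →ₗ[K] K)) := by
      rw [puncturedTwistedGabidulin_eq_image hm hn hmn ht (by omega)]
      refine ⟨_, ⟨fun i hi => by rw [hc.1 i hi, map_zero], π.injective ?_⟩, rfl⟩
      rw [π.apply_symm_apply, map_mul, hπ, hπ, ← map_pow, ← map_pow, hroot, hc.2]
    have hmem' := himg.subset (Set.mem_image_of_mem τ hmem)
    rw [SetLike.mem_coe, mem_puncturedTwistedGabidulin_iff hm hn hmn ht (by omega)] at hmem'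
    obtain ⟨c', hc', hf⟩ := hmem'
    refine ⟨c', hc', fun x => eq_of_forall_trace_mul (K := K) fun y => ?_⟩
    rw [← hf, hτ, traceForm_comp_apply, hθ, ← trace_pow_char_pow, mul_pow, linPoly_pow_char_pow,
      ← hGg, ← hAg, trace_linPoly_mul hn]
    simp only [hroot, b]
  have hbar : ∀ z w : ℤ, (z : ZMod m) = w ↔ z ≡ w [ZMOD m] := fun z w =>
    ZMod.intCast_eq_intCast_iff z w m
  have hσ : (s : ZMod m) = t - ZMod.castHom hmn (ZMod m) ((t : ZMod n) - (s : ZMod n)) := by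
    rw [map_sub, map_natCast, map_intCast, sub_sub_cancel]
  obtain ⟨hw, i₀, hi₀, hane, hbi, hrel⟩ := monomial_of_maps_isTwistedCoeff hm hn hmn hκ ht htm
    ((map_ne_zero _).2 (pow_ne_zero _ hμ)) hσ (fun h => hs0 ((hbar _ _).1 (by simpa using h)))
    (fun h => hs1 ((hbar _ _).1 (by simpa using h)))
    (fun h => hs1' ((hbar _ _).1 (by simpa using h)))
    (fun h => hs2 ((hbar _ _).1 (by simpa using h)))
    (fun h => hs2' ((hbar _ _).1 (by simpa using h))) hAa hA.2 hl₀ H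
  have hsu : (s : ZMod m) = u := by
    rw [map_sub, map_sub, map_natCast, map_intCast, map_intCast] at hw
    exact sub_right_injective hw
  obtain ⟨i, hi⟩ := ZMod.intCast_surjective i₀
  have ha1 : algebraMap F L (A 1) = a i₀ := by
    rw [hAa, linPoly_apply, Finset.sum_eq_single_of_mem i₀ (Finset.mem_univ _)
      (fun j _ hj => by rw [hane j hj, zero_mul]), map_one, mul_one]
  -- Chosen so that the monomial `A` is `x ↦ (a' x)^(q^(κ i₀))`.
  let a' : F := twist K (-k) (-i₀) (A 1)
  have ha' : a i₀ = twist K (-k) (i : ZMod n) (algebraMap F L a') := by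
    rw [twist_algebraMap hm hn hmn, map_intCast, hi, twist_apply_twist_neg hm, ha1]
  have hfix : ∀ z w : ZMod n, ZMod.castHom hmn (ZMod m) z = ZMod.castHom hmn (ZMod m) w →
      twist K (-k) z (algebraMap F L a') = twist K (-k) w (algebraMap F L a') := by
    intro z w hzw
    rw [twist_algebraMap hm hn hmn, twist_algebraMap hm hn hmn, hzw]
  have hsupp : ∀ l, b (l - (i : ZMod n)) ≠ 0 → ZMod.castHom hmn (ZMod m) l = 0 := by
    intro l hl
    have := hbi _ hl
    rwa [map_sub, map_intCast, hi, sub_eq_neg_self] at this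
  rw [equivCondition_iff p hn hmn hk]
  -- The array of the condition belongs to `G` followed by the twist by `-i`, which moves the
  -- support to the multiples of `m` and stays injective.
  refine ⟨(hbar s u).1 hsu, e, i, a', fun l => twist K (-k) (-l) (b (l - (i : ZMod n))), ?_,
    fun l hl => hsupp l (by simpa using hl), ?_, fun l => ?_⟩
  · rintro h0
    rw [ha', h0, map_zero, map_zero] at hi₀
    exact hi₀ rfl
  · intro y y' hy
    simp only [b] at hy
    rw [linPoly_adjoint_shift hn, linPoly_adjoint_shift hn] at hy
    exact hG.1 ((twist K (-k) (-(i : ZMod n))).injective hy)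
  · by_cases hl : ZMod.castHom hmn (ZMod m) l = 0
    · have h := congrArg (twist K (-k) (-(t : ZMod n))) (hrel (l - i + (t - s)))
      rw [add_sub_cancel_right, ha'] at h
      simp only [map_mul, ← twist_add hn] at h ⊢
      rw [show -(t : ZMod n) + (l - i + t) = l - i by ring,
        show -(t : ZMod n) + (l - i + t + i) = l by ring,
        show -(t : ZMod n) + (t - u) = -u by ring, neg_add_cancel, twist_zero,
        show -(t : ZMod n) + (l - i + (t - s) + i) = l - s by ring,
        show l - (i : ZMod n) + (t - s) - (t - u) = l - (s - u) - i by ring,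
        hfix l 0 (by rw [hl, map_zero]), twist_zero,
        hfix (l - s) (-u) (by rw [map_sub, map_neg, map_intCast, map_intCast, hl, hsu, zero_sub])]
        at h
      rw [show l - (t : ZMod n) + -l = -t by ring,
        show l - (s : ZMod n) + -(l - (s - u)) = -u by ring]
      linear_combination h
    · have h1 : b (l - (i : ZMod n)) = 0 := by
        by_contra h0
        exact hl (hsupp l h0)
      have h2 : b (l - ((s : ZMod n) - (u : ZMod n)) - (i : ZMod n)) = 0 := by
        by_contra h0
        have := hsupp _ h0
        rw [map_sub, map_sub, map_intCast, map_intCast, hsu, sub_self, sub_zero] at this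
        exact hl this
      simp only [h1, h2, map_zero, mul_zero]

theorem EquivCondition.productEquiv (p : ℕ) [Fact p.Prime] [CharP K p]
    (hm : Module.finrank K F = m)
    (hn : Module.finrank K L = n) (hmn : m ∣ n) {k t : ℕ} (hk : IsCoprime (k : ℤ) n) (ht : 1 ≤ t)
    (htm : t + 2 ≤ m) {s u : ℤ} {μ ν : L} (h : EquivCondition K F L p m n k t μ ν s u) :
    ProductEquiv
      (puncturedTwistedGabidulin K F L k t μ s : Set (F →ₗ[K] L →ₗ[K] K))
      (puncturedTwistedGabidulin K F L k t ν u : Set (F →ₗ[K] L →ₗ[K] K)) := by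
  rw [equivCondition_iff p hn hmn hk] at h
  obtain ⟨-, e, i, a, b, ha, hb, hinj, heq⟩ := h
  have hκm : IsCoprime (-k : ℤ) m :=
    hk.neg_left.of_isCoprime_of_dvd_right (Int.natCast_dvd_natCast.2 hmn)
  let A : F →ₗ[K] F := (twist K (-k) (i : ZMod m) : F ≃ₐ[K] F).toLinearMap ∘ₗ LinearMap.mulLeft K a
  have hA : Function.Injective A :=
    (twist K (-k) (i : ZMod m)).injective.comp (mul_right_injective₀ ha)
  let G : L →ₗ[K] L := (twist K (-k) (i : ZMod n) : L ≃ₐ[K] L).toLinearMap ∘ₗ linPoly (k : ℤ) b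
  have hG : Function.Injective G := (twist K (-k) (i : ZMod n)).injective.comp hinj
  obtain ⟨g, hg, hAg⟩ := exists_addEquiv_pow_eq p e hA
  obtain ⟨g', hg', hGg⟩ := exists_addEquiv_pow_eq p e hG
  obtain ⟨τ, hτ, hτf⟩ := exists_productAut (iterateFrobeniusEquiv K p e) g g' hg hg'
  have hfin : Finite (F →ₗ[K] L →ₗ[K] K) := Module.finite_of_finite K
  -- Inclusion suffices, since the two codes have equally many elements.
  refine ⟨τ, hτ, Set.eq_of_subset_of_ncard_le ?_ ?_ (Set.toFinite _)⟩
  · rw [puncturedTwistedGabidulin_eq_image hm hn hmn ht (by omega)]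
    rintro _ ⟨_, ⟨c, hc, rfl⟩, rfl⟩
    have := charP_of_algebra p K L
    have hc2 : IsTwistedCoeff K (-k) t (twist K (-k) (t : ZMod n) (μ ^ p ^ e))
        ((t : ZMod n) - (s : ZMod n)) (fun i => c i ^ p ^ e) :=
      ⟨fun i hi => by
        dsimp only
        rw [hc.1 i hi, zero_pow (pow_ne_zero _ (Fact.out : p.Prime).ne_zero)],
        by dsimp only; rw [hc.2, mul_pow, map_pow, map_pow]⟩
    obtain ⟨c', hc', hcc⟩ := exists_isTwistedCoeff_of_condition hm hn hmn hb heq hc2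
    rw [SetLike.mem_coe, mem_puncturedTwistedGabidulin_iff hm hn hmn ht (by omega)]
    refine ⟨c', hc', fun x y => ?_⟩
    rw [hτf, traceForm_comp_apply, iterateFrobeniusEquiv_def, ← trace_pow_char_pow, mul_pow,
      linPoly_pow_char_pow, ← hGg, ← hAg, ← hcc]
    rfl
  · rw [Set.ncard_image_of_injective _ τ.injective,
      puncturedTwistedGabidulin_eq_image hm hn hmn ht (by omega),
      puncturedTwistedGabidulin_eq_image hm hn hmn ht (by omega),
      Set.ncard_image_of_injective _ (traceForm_comp_linPoly_injective hm hκm),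
      Set.ncard_image_of_injective _ (traceForm_comp_linPoly_injective hm hκm)]
    exact ncard_isTwistedCoeff_le ht (by omega) _ _ _ _

end Equivalence

end

end PuncturedCodes

theorem mainTheorem5 (p : ℕ) [Fact p.Prime]
    (K F L : Type*) [Field K] [Fintype K] [CharP K p] [Field F] [Field L] [Finite L]
    [Algebra K F] [Algebra K L] [Algebra F L] [IsScalarTower K F L]
    (m n : ℕ) (hm : Module.finrank K F = m) (hn : Module.finrank K L = n)
    (hm1 : 1 < m) (hmn : m ∣ n)
    (k : ℕ) (hk0 : 0 < k) (hk : Nat.Coprime k n)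
    (t : ℕ) (ht1 : 1 ≤ t) (ht2 : t ≤ m - 2)
    (s u : ℤ)
    (hs0 : ¬ s ≡ 0 [ZMOD m]) (hs1 : ¬ s ≡ 1 [ZMOD m]) (hs1' : ¬ s ≡ -1 [ZMOD m])
    (hs2 : ¬ s ≡ 2 [ZMOD m]) (hs2' : ¬ s ≡ -2 [ZMOD m])
    (μ ν : L) (hμ0 : μ ≠ 0)
    (hμ : Algebra.norm K μ ≠ (-1) ^ (n * t)) (hν : Algebra.norm K ν ≠ (-1) ^ (n * t)) :
    (m < n →
      (PuncturedCodes.CodeEquiv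
          (PuncturedCodes.puncturedTwistedGabidulin K F L k t μ s : Set (F →ₗ[K] L →ₗ[K] K))
          (PuncturedCodes.puncturedTwistedGabidulin K F L k t ν u : Set (F →ₗ[K] L →ₗ[K] K)) ↔
        PuncturedCodes.EquivCondition K F L p m n k t μ ν s u)) ∧
    (m = n →
      (PuncturedCodes.ProductEquiv
          (PuncturedCodes.puncturedTwistedGabidulin K F L k t μ s : Set (F →ₗ[K] L →ₗ[K] K))
          (PuncturedCodes.puncturedTwistedGabidulin K F L k t ν u : Set (F →ₗ[K] L →ₗ[K] K)) ↔
        PuncturedCodes.EquivCondition K F L p m n k t μ ν s u)) := by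
  have hF : Finite F := Finite.of_injective _ (algebraMap F L).injective
  have hm0 : NeZero m := ⟨by omega⟩
  have hn0 : NeZero n := ⟨hn ▸ Module.finrank_pos.ne'⟩
  have hk' : IsCoprime (k : ℤ) n := Nat.isCoprime_iff_coprime.2 hk
  have hiff : PuncturedCodes.ProductEquiv
      (PuncturedCodes.puncturedTwistedGabidulin K F L k t μ s : Set (F →ₗ[K] L →ₗ[K] K))
      (PuncturedCodes.puncturedTwistedGabidulin K F L k t ν u : Set (F →ₗ[K] L →ₗ[K] K)) ↔
      PuncturedCodes.EquivCondition K F L p m n k t μ ν s u :=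
    ⟨PuncturedCodes.ProductEquiv.equivCondition p hm hn hmn hk' ht1 (by omega) hs0 hs1 hs1' hs2
      hs2' hμ0, PuncturedCodes.EquivCondition.productEquiv p hm hn hmn hk' ht1 (by omega)⟩
  refine ⟨fun hlt => ?_, fun _ => hiff⟩
  rw [← hiff]
  constructor
  · rintro ⟨τ, hτ, himg⟩
    exact ⟨τ, hτ.isProductAut (by omega) (by omega), himg⟩
  · rintro ⟨τ, hτ, himg⟩
    exact ⟨τ, hτ.isRankAut, himg⟩
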